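/- Let $\alpha>1$ and $c>0$, and let $v:\mathbb R\to[0,\infty)$ be a Borel probability density such that $v(y)=0$ for $y\le 0$ and $v(y)=c(y)\,y^{-1-\alpha}$ for $y>0$, where $c(\cdot):[0,\infty)\to(0,\infty)$ satisfies $\sup_{y} c(y)<\infty$ and $\lim_{y\to\infty}c(y)=c$. Let $(Z_n)_{n\ge 0}$ be the homogeneous random walk on $\mathbb R$ with symmetric increment density $w(y)=\tfrac12 v(|y|)$, that is, the time-homogeneous Markov process with $\mathbb P[Z_{n+1}\in B\mid Z_n=y]=\int_B w(z-y)\,dz$ for all $y\in\mathbb R$ and Borel sets $B\subseteq\mathbb R$. For $a>0$ let $\tau_a=\min\{n\ge 0: |Z_n|\le a\}$ (with $\min\emptyset=+\infty$), and let $\mathbb E_x$ denote expectation for the walk started from $Z_0=x$. Then for every $a>0$, every $x\notin[-a,a]$ and every $q\in\mathbb R$: (i) if $\alpha\ge 2$, then $\mathbb E_x[\tau_a^q]<\infty$ if $q<\tfrac12$, and $\mathbb E_x[\tau_a^q]=\infty$ if $q>\tfrac12$; (ii) if $\alpha\in(1,2)$, then $\mathbb E_x[\tau_a^q]<\infty$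 if $q<1-\tfrac1\alpha$, and $\mathbb E_x[\tau_a^q]=\infty$ if $q>1-\tfrac1\alpha$. -/

import Mathlib

open MeasureTheory Filter Topology
open scoped ENNReal

namespace HeavyTailed

/-- The class of one-sided heavy-tailed probability densities with tail exponent `α` and tail
constant `c`: `v` is a Borel probability density on the line that vanishes on `(-∞, 0]` and has
the form `v y = C y * y ^ (-1 - α)` for `y > 0`, where `C` is a positive bounded function on
`[0, ∞)` with `C y → c` as `y → ∞`. -/
structure IsTailDensity (α c : ℝ) (v : ℝ → ℝ) : Prop where
  measurable : Measurable v
  nonneg : ∀ y, 0 ≤ v y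
  lintegral_eq_one : ∫⁻ y, ENNReal.ofReal (v y) = 1
  tail : ∃ C : ℝ → ℝ, (∀ y, 0 ≤ y → 0 < C y) ∧ BddAbove (C '' Set.Ici 0) ∧
    Tendsto C atTop (𝓝 c) ∧ ∀ y, 0 < y → v y = C y * y ^ (-1 - α)
  eq_zero : ∀ y, y ≤ 0 → v y = 0

/-- The symmetric two-sided density `w y = v |y| / 2` built from a one-sided density `v`. -/
noncomputable def symDensity (v : ℝ → ℝ) (y : ℝ) : ℝ := (1 / 2) * v |y|

/-- `Z` is a spatially homogeneous random walk on the line with increment density `w`, started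
at `x`: a time-homogeneous Markov process whose transition law from `y` has density
`z ↦ w (z - y)`. The Markov property says that, conditionally on the history
`σ(Z 0, …, Z n)`, the event `Z (n + 1) ∈ B` has probability `∫ z in B, w (z - Z n)`. -/
structure IsRandomWalk {Ω : Type*} [MeasurableSpace Ω] (P : Measure Ω) (w : ℝ → ℝ) (x : ℝ)
    (Z : ℕ → Ω → ℝ) : Prop where
  measurable : ∀ n, Measurable (Z n)
  start : ∀ᵐ ω ∂P, Z 0 ω = x
  markov : ∀ (n : ℕ) (A : Set Ω),
    MeasurableSet[⨆ k ≤ n, MeasurableSpace.comap (Z k) inferInstance] A →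
    ∀ B : Set ℝ, MeasurableSet B →
      P (A ∩ Z (n + 1) ⁻¹' B) = ∫⁻ ω in A, (∫⁻ z in B, ENNReal.ofReal (w (z - Z n ω))) ∂P

/-- The passage time `τ_a = min {n ≥ 0 : |Z n| ≤ a}`, equal to `∞` if there is no such `n`. -/
noncomputable def passageTime {Ω : Type*} (Z : ℕ → Ω → ℝ) (a : ℝ) (ω : Ω) : ℕ∞ :=
  ⨅ (n : ℕ) (_ : |Z n ω| ≤ a), (n : ℕ∞)

/-- The `q`-th moment `E[τ_a ^ q] ∈ [0, ∞]` of the passage time. -/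
noncomputable def passageMoment {Ω : Type*} [MeasurableSpace Ω] (P : Measure Ω)
    (Z : ℕ → Ω → ℝ) (a q : ℝ) : ℝ≥0∞ :=
  ∫⁻ ω, ((passageTime Z a ω : ℕ∞) : ℝ≥0∞) ^ q ∂P

end HeavyTailed

/-! Let φ be the characteristic function of the increments, real by symmetry, and β = `min α 2`;
both cases assert the threshold 1 - 1/β. The Fejér kernel has cosine transform supported in [-a, a],
so dividing it by 1 - sφ and transforming gives a function G (`potential`) that equals s times its
one-step average off [-a, a] (`potential_sub_mul_integral`). Hence s^n G(Z n), stopped at τ, is a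
bounded martingale, and optional stopping (`setIntegral_stoppedDiscount`) ties G to E[s^τ].

Near 0, 1 - φ(t) is at least of order |t|^β and at most of order |t|^b for each b < β. So, up to
arbitrarily small losses in the exponent, G(0) grows like (1-s)^(1/β-1) as s → 1
(`potential_zero_ge`, `potential_zero_le`), while G(0) - G(y) stays bounded for fixed y
(`potential_zero_sub_le`). As G ≤ G(0), stopping from x gives G(0)(1 - E[s^τ]) ≤ G(0) - G(x). Thus 1
- E[s^τ] is at most of order (1-s)^(1-1/b), and a sum over dyadic scales bounds the moments below
the threshold.

Conversely, G(0) - G(y) is large for suitable distant y (`exists_le_potential_zero_sub`), and one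
jump reaches such y with positive probability, so G(0)(1 - E[s^τ]) stays away from 0
(`le_potential_zero_mul`). A finite moment of order q ≤ 1 makes 1 - E[s^τ] = O((1-s)^q), which for q
> 1 - 1/β contradicts the upper bound on G(0). -/

namespace HeavyTailed

/-! ### The Fejér kernel -/

/-- The Fejér-type kernel `t ↦ (1 - cos (a t)) / t ^ 2`. -/
noncomputable def fejer (a t : ℝ) : ℝ := (1 - Real.cos (a * t)) / t ^ 2

theorem fejer_nonneg (a t : ℝ) : 0 ≤ fejer a t :=
  div_nonneg (by linarith [Real.cos_le_one (a * t)]) (sq_nonneg t)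

theorem measurable_fejer (a : ℝ) : Measurable (fejer a) := by
  unfold fejer; fun_prop

theorem fejer_le (a t : ℝ) : fejer a t ≤ a ^ 2 / 2 := by
  rcases eq_or_ne t 0 with rfl | ht
  · simp [fejer]; positivity
  · rw [fejer, div_le_iff₀ (by positivity)]
    nlinarith [Real.one_sub_sq_div_two_le_cos (x := a * t)]

theorem fejer_lower {a t : ℝ} (ht : t ≠ 0) (h : |a * t| ≤ 1) : a ^ 2 / 8 ≤ fejer a t := by
  have h1 := Real.cos_le_one_sub_mul_cos_sq (x := a * t) (by linarith [Real.pi_gt_three])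
  rw [fejer, le_div_iff₀ (by positivity)]
  have h2 : (1 : ℝ) / 8 ≤ 2 / Real.pi ^ 2 := by
    rw [div_le_div_iff₀ (by norm_num) (by positivity)]
    nlinarith [Real.pi_lt_four, Real.pi_pos]
  nlinarith [mul_le_mul_of_nonneg_right h2 (sq_nonneg (a * t))]

theorem integrable_fejer (a : ℝ) : Integrable (fejer a) := by
  refine (integrable_inv_one_add_sq.const_mul (a ^ 2 / 2 + 2)).mono'
    (measurable_fejer a).aestronglyMeasurable (ae_of_all _ fun t => ?_)
  rw [Real.norm_of_nonneg (fejer_nonneg a t), ← div_eq_mul_inv, le_div_iff₀ (by positivity)]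
  have h1 := fejer_le a t
  have h2 : fejer a t * t ^ 2 ≤ 2 := by
    rcases eq_or_ne t 0 with rfl | ht
    · simp
    · rw [fejer, div_mul_cancel₀ _ (by positivity)]
      linarith [Real.neg_one_le_cos (a * t)]
  linarith

/-- Scaling `t ↦ a * t`. The value of the integral at `a = 1` is never needed. -/
theorem integral_fejer (a : ℝ) : ∫ t, fejer a t = |a| * ∫ t, fejer 1 t := by
  rcases eq_or_ne a 0 with rfl | ha
  · simp [fejer]
  · have h : ∀ t, fejer a t = a ^ 2 * fejer 1 (a * t) := fun t => by
      simp only [fejer, one_mul, mul_pow]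
      field_simp
    simp_rw [h]
    rw [integral_const_mul, Measure.integral_comp_mul_left, smul_eq_mul, ← mul_assoc]
    congr 1
    rw [abs_inv, ← sq_abs]
    field_simp

/-- The cosine transform of the Fejér kernel is supported in `[-a, a]`. -/
theorem integral_fejer_mul_cos {a y : ℝ} (ha : 0 < a) (hy : a < |y|) :
    ∫ t, fejer a t * Real.cos (t * y) = 0 := by
  -- Product-to-sum turns the integral into a multiple of |a + y| + |y - a| - 2|y|, which vanishes
  -- once |y| > a.
  have h : ∀ t, fejer a t * Real.cos (t * y)
      = (1 / 2) * (fejer (a + y) t + fejer (y - a) t) - fejer y t := fun t => by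
    simp only [fejer, add_mul, sub_mul, Real.cos_add, Real.cos_sub, mul_comm t y]
    ring
  simp_rw [h]
  have hI : Integrable fun t => (1 / 2) * (fejer (a + y) t + fejer (y - a) t) :=
    ((integrable_fejer _).add (integrable_fejer _)).const_mul _
  rw [integral_sub hI (integrable_fejer _), integral_const_mul, integral_add (integrable_fejer _)
    (integrable_fejer _), integral_fejer (a + y), integral_fejer (y - a), integral_fejer y,
    ← add_mul, ← mul_assoc, ← sub_mul]
  refine mul_eq_zero_of_left ?_ _
  rcases lt_abs.1 hy with h1 | h1
  · rw [abs_of_pos (a := y), abs_of_pos (a := a + y), abs_of_pos (a := y - a)] <;> linarith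
  · rw [abs_of_neg (a := y), abs_of_neg (a := a + y), abs_of_neg (a := y - a)] <;> linarith

/-! ### The increment law and its characteristic function near 0 -/

/-- The increment law with density `symDensity v`. -/
noncomputable def incrementLaw (v : ℝ → ℝ) : Measure ℝ :=
  volume.withDensity fun y => ENNReal.ofReal (symDensity v y)

/-- The real part of the characteristic function of `ν`. -/
noncomputable def cosTransform (ν : Measure ℝ) (t : ℝ) : ℝ := ∫ y, Real.cos (t * y) ∂ν

theorem symDensity_neg (v : ℝ → ℝ) (y : ℝ) : symDensity v (-y) = symDensity v y := by
  simp [symDensity]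

theorem cosTransform_neg (ν : Measure ℝ) (t : ℝ) : cosTransform ν (-t) = cosTransform ν t := by
  simp [cosTransform]

theorem cosTransform_abs (ν : Measure ℝ) (t : ℝ) : cosTransform ν |t| = cosTransform ν t := by
  rcases abs_choice t with h | h <;> rw [h]
  exact cosTransform_neg ν t

theorem abs_cosTransform_le {ν : Measure ℝ} [IsProbabilityMeasure ν] (t : ℝ) : |cosTransform ν t| ≤ 1 := by
  have h := norm_integral_le_of_norm_le_const (μ := ν) (f := fun y => Real.cos (t * y)) (C := 1)
    (ae_of_all _ fun y => Real.abs_cos_le_one _)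
  rw [probReal_univ, mul_one] at h
  exact h

/-- Interpolation between the bounds u²/2, used for |u| ≤ 1, and 2, used for |u| ≥ 1. -/
theorem one_sub_cos_le_two_mul_rpow {b : ℝ} (hb : b ≤ 2) (hb0 : 0 < b) (u : ℝ) :
    1 - Real.cos u ≤ 2 * |u| ^ b := by
  rcases le_total |u| 1 with h | h
  · have h1 : |u| ^ (2 : ℝ) ≤ |u| ^ b := by
      rcases eq_or_ne u 0 with rfl | hu
      · simp [Real.zero_rpow hb0.ne']
      · exact Real.rpow_le_rpow_of_exponent_ge (abs_pos.2 hu) h hb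
    rw [Real.rpow_two, sq_abs] at h1
    nlinarith [Real.one_sub_sq_div_two_le_cos (x := u), sq_nonneg u]
  · have := Real.one_le_rpow h hb0.le
    linarith [Real.neg_one_le_cos u]

namespace IsTailDensity

variable {α c : ℝ} {v : ℝ → ℝ}

theorem measurable_symDensity (hv : IsTailDensity α c v) : Measurable (symDensity v) := by
  have := hv.measurable
  unfold symDensity
  fun_prop

theorem symDensity_nonneg (hv : IsTailDensity α c v) (y : ℝ) : 0 ≤ symDensity v y :=
  mul_nonneg (by norm_num) (hv.nonneg _)

theorem integrable (hv : IsTailDensity α c v) : Integrable v := by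
  refine ⟨hv.measurable.aestronglyMeasurable, ?_⟩
  rw [hasFiniteIntegral_iff_ofReal (ae_of_all _ hv.nonneg), hv.lintegral_eq_one]
  exact ENNReal.one_lt_top

theorem integral_eq_one (hv : IsTailDensity α c v) : ∫ y, v y = 1 := by
  rw [integral_eq_lintegral_of_nonneg_ae (ae_of_all _ hv.nonneg)
    hv.measurable.aestronglyMeasurable, hv.lintegral_eq_one, ENNReal.toReal_one]

theorem symDensity_eq (hv : IsTailDensity α c v) (y : ℝ) :
    symDensity v y = (1 / 2) * (v y + v (-y)) := by
  rcases le_total 0 y with h | h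
  · rw [symDensity, abs_of_nonneg h, hv.eq_zero (-y) (by linarith), add_zero]
  · rw [symDensity, abs_of_nonpos h, hv.eq_zero y h, zero_add]

theorem integrable_symDensity (hv : IsTailDensity α c v) : Integrable (symDensity v) := by
  simp_rw [funext hv.symDensity_eq]
  exact (hv.integrable.add hv.integrable.comp_neg).const_mul _

theorem integral_symDensity (hv : IsTailDensity α c v) : ∫ y, symDensity v y = 1 := by
  simp_rw [funext hv.symDensity_eq]
  rw [integral_const_mul, integral_add hv.integrable hv.integrable.comp_neg,
    integral_neg_eq_self, hv.integral_eq_one]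
  norm_num

theorem isProbabilityMeasure_incrementLaw (hv : IsTailDensity α c v) :
    IsProbabilityMeasure (incrementLaw v) := by
  refine ⟨?_⟩
  rw [incrementLaw, withDensity_apply _ MeasurableSet.univ, Measure.restrict_univ,
    ← ofReal_integral_eq_lintegral_ofReal hv.integrable_symDensity
      (ae_of_all _ hv.symDensity_nonneg), hv.integral_symDensity, ENNReal.ofReal_one]

theorem integral_incrementLaw (hv : IsTailDensity α c v) (f : ℝ → ℝ) :
    ∫ y, f y ∂(incrementLaw v) = ∫ y, symDensity v y * f y := by
  rw [incrementLaw, integral_withDensity_eq_integral_toReal_smul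
    hv.measurable_symDensity.ennreal_ofReal (ae_of_all _ fun _ => ENNReal.ofReal_lt_top)]
  simp only [ENNReal.toReal_ofReal (hv.symDensity_nonneg _), smul_eq_mul]

theorem integral_sin_incrementLaw (hv : IsTailDensity α c v) (t : ℝ) :
    ∫ y, Real.sin (t * y) ∂(incrementLaw v) = 0 := by
  rw [hv.integral_incrementLaw]
  have h := integral_neg_eq_self (fun y => symDensity v y * Real.sin (t * y)) volume
  simp only [symDensity_neg, mul_neg, Real.sin_neg, integral_neg] at h
  linarith

theorem one_sub_cosTransform (hv : IsTailDensity α c v) (t : ℝ) :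
    1 - cosTransform (incrementLaw v) t = ∫ y, symDensity v y * (1 - Real.cos (t * y)) := by
  have := hv.isProbabilityMeasure_incrementLaw
  rw [← hv.integral_incrementLaw, integral_sub (integrable_const _)]
  · simp [cosTransform]
  · exact Integrable.of_bound (by fun_prop) 1 (ae_of_all _ fun y => Real.abs_cos_le_one _)

theorem integrable_symDensity_mul_one_sub_cos (hv : IsTailDensity α c v) (t : ℝ) :
    Integrable fun y => symDensity v y * (1 - Real.cos (t * y)) := by
  refine hv.integrable_symDensity.mul_bdd (c := 2) (by fun_prop) (ae_of_all _ fun y => ?_)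
  rw [Real.norm_eq_abs, abs_le]
  constructor <;> linarith [Real.cos_le_one (t * y), Real.neg_one_le_cos (t * y)]

theorem symDensity_pos (hv : IsTailDensity α c v) {y : ℝ} (hy : y ≠ 0) : 0 < symDensity v y := by
  obtain ⟨C, hC, -, -, h⟩ := hv.tail
  rw [symDensity, h _ (abs_pos.2 hy)]
  have := hC _ (abs_nonneg y)
  have := Real.rpow_pos_of_pos (abs_pos.2 hy) (-1 - α)
  positivity

theorem setLIntegral_symDensity_sub_pos (hv : IsTailDensity α c v) {l r : ℝ} (h : l < r)
    (x : ℝ) : 0 < ∫⁻ z in Set.Icc l r, ENNReal.ofReal (symDensity v (z - x)) := by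
  have hm := hv.measurable_symDensity
  rw [setLIntegral_pos_iff (by fun_prop)]
  refine lt_of_lt_of_le ?_ (measure_mono (s := Set.Icc l r \ {x}) ?_)
  · rw [measure_sdiff_null (by simp)]
    simpa using h
  · rintro z ⟨hz, hzx⟩
    exact ⟨(ENNReal.ofReal_pos.2 (hv.symDensity_pos (sub_ne_zero.2 hzx))).ne', hz⟩

/-- The factor 1/4 is 1/2 from symmetrization times 1/2 from `C y > c / 2` far out; the decreasing
power is taken at the right end `r`. -/
theorem exists_symDensity_lower (hv : IsTailDensity α c v) (hc : 0 < c) (hα : 1 < α) :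
    ∃ Y : ℝ, 1 ≤ Y ∧ ∀ r y : ℝ, Y ≤ y → y ≤ r → c / 4 * r ^ (-1 - α) ≤ symDensity v y := by
  obtain ⟨C, hC, -, hlim, h⟩ := hv.tail
  obtain ⟨Y, hY⟩ := eventually_atTop.1 (hlim.eventually (lt_mem_nhds (half_lt_self hc)))
  refine ⟨max Y 1, le_max_right _ _, fun r y hy hr => ?_⟩
  have hy1 : 1 ≤ y := (le_max_right _ _).trans hy
  have h1 := hY y ((le_max_left _ _).trans hy)
  rw [symDensity, abs_of_nonneg (by linarith), h y (by linarith)]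
  have h2 : r ^ (-1 - α) ≤ y ^ (-1 - α) :=
    Real.rpow_le_rpow_of_nonpos (by linarith) hr (by linarith)
  have h3 : 0 ≤ y ^ (-1 - α) := Real.rpow_nonneg (by linarith) _
  nlinarith

/-- A lower bound for the symbol of the walk from an interval in the region where the tail of the
density is regular. -/
theorem exists_one_sub_cosTransform_ge (hv : IsTailDensity α c v) (hc : 0 < c) (hα : 1 < α) :
    ∃ Y : ℝ, 1 ≤ Y ∧ ∀ l r t : ℝ, Y ≤ l → l ≤ r →
      c / 4 * r ^ (-1 - α) * ∫ y in l..r, (1 - Real.cos (t * y))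
        ≤ 1 - cosTransform (incrementLaw v) t := by
  obtain ⟨Y, hY1, hY⟩ := hv.exists_symDensity_lower hc hα
  refine ⟨Y, hY1, fun l r t hl hr => ?_⟩
  have hcos : ∀ y, 0 ≤ 1 - Real.cos (t * y) := fun y => by linarith [Real.cos_le_one (t * y)]
  rw [hv.one_sub_cosTransform, intervalIntegral.integral_of_le hr, ← integral_const_mul]
  refine le_trans (setIntegral_mono_on ?_
    (hv.integrable_symDensity_mul_one_sub_cos t).integrableOn measurableSet_Ioc fun y hy =>
      mul_le_mul_of_nonneg_right (hY r y (hl.trans hy.1.le) hy.2) (hcos y))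
    (setIntegral_le_integral (hv.integrable_symDensity_mul_one_sub_cos t)
      (ae_of_all _ fun y => mul_nonneg (hv.symDensity_nonneg y) (hcos y)))
  exact (Continuous.integrableOn_Icc (by fun_prop)).mono_set Set.Ioc_subset_Icc_self

theorem exists_rpow_le_one_sub_cosTransform (hv : IsTailDensity α c v) (hc : 0 < c)
    (hα : 1 < α) :
    ∃ κ : ℝ, 0 < κ ∧ ∀ t, κ * (min 1 |t|) ^ α ≤ 1 - cosTransform (incrementLaw v) t := by
  obtain ⟨Y, hY1, hY⟩ := hv.exists_one_sub_cosTransform_ge hc hα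
  have := hv.isProbabilityMeasure_incrementLaw
  refine ⟨c / 4 * (4 * Y) ^ (-1 - α), mul_pos (by linarith)
    (Real.rpow_pos_of_pos (by linarith) _), fun t => ?_⟩
  rcases eq_or_ne t 0 with rfl | ht0
  · simpa [Real.zero_rpow (by linarith : α ≠ 0)] using (abs_le.1 (abs_cosTransform_le 0)).2
  rw [← cosTransform_abs]
  have ht : 0 < |t| := abs_pos.2 ht0
  generalize |t| = t at ht
  set m := min 1 t with hm
  have hm0 : 0 < m := lt_min one_pos ht
  have hm1 : m ≤ 1 := min_le_left _ _
  have hmt : m ≤ t := min_le_right _ _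
  have hl : Y ≤ Y / m := by rw [le_div_iff₀ hm0]; nlinarith
  have hlt : 1 ≤ t * (Y / m) := by
    rw [mul_div_assoc', le_div_iff₀ hm0]; nlinarith
  -- A window at scale 1/m of length 3Y/m: the oscillating part of the integral is at most 2/t ≤
  -- 2Y/m, which leaves at least Y/m ≥ 1/m.
  refine le_trans ?_ (hY (Y / m) (4 * (Y / m)) t hl (by linarith))
  have hint : 1 / m ≤ ∫ y in (Y / m)..(4 * (Y / m)), (1 - Real.cos (t * y)) := by
    rw [intervalIntegral.integral_sub (by simp) (Continuous.intervalIntegrable (by fun_prop) _ _),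
      intervalIntegral.integral_comp_mul_left (fun u => Real.cos u) ht.ne', integral_cos]
    simp only [intervalIntegral.integral_const, smul_eq_mul, mul_one]
    have h1 : t⁻¹ * (Real.sin (t * (4 * (Y / m))) - Real.sin (t * (Y / m))) ≤ t⁻¹ * 2 := by
      gcongr
      linarith [Real.sin_le_one (t * (4 * (Y / m))), Real.neg_one_le_sin (t * (Y / m))]
    have h2 : t⁻¹ ≤ Y / m := by
      rw [inv_le_iff_one_le_mul₀ ht]; linarith
    have h3 : 1 / m ≤ Y / m := by gcongr
    linarith
  calc c / 4 * (4 * Y) ^ (-1 - α) * m ^ α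
      = c / 4 * (4 * (Y / m)) ^ (-1 - α) * (1 / m) := by
        have h1 : m ^ (-1 - α) = (m ^ α * m)⁻¹ := by
          rw [← Real.rpow_add_one hm0.ne', ← Real.rpow_neg hm0.le]
          ring_nf
        have h2 := Real.rpow_pos_of_pos hm0 α
        rw [show 4 * (Y / m) = 4 * Y / m by ring, Real.div_rpow (by linarith) hm0.le, h1]
        field_simp
    _ ≤ _ := by
        have : 0 ≤ (4 * (Y / m)) ^ (-1 - α) := Real.rpow_nonneg (by linarith) _
        gcongr

/-- For α > 2 the order |t|^α is too weak near 0. The fixed window [Y, 2Y] gives order t² for |t| ≤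
1/(2Y), where |ty| ≤ 1; for larger |t| the previous bound is already bounded below by a constant. -/
theorem exists_sq_le_one_sub_cosTransform (hv : IsTailDensity α c v) (hc : 0 < c)
    (hα : 1 < α) :
    ∃ κ : ℝ, 0 < κ ∧ ∀ t, κ * (min 1 |t|) ^ (2 : ℝ) ≤ 1 - cosTransform (incrementLaw v) t := by
  obtain ⟨κ, hκ, hκt⟩ := hv.exists_rpow_le_one_sub_cosTransform hc hα
  obtain ⟨Y, hY1, hY⟩ := hv.exists_one_sub_cosTransform_ge hc hα
  set κ₁ := κ * (1 / (2 * Y)) ^ α with hκ₁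
  set κ₂ := c / 4 * (2 * Y) ^ (-1 - α) * (Y * (1 / 8)) with hκ₂
  have hp : 0 < (2 * Y) ^ (-1 - α) := Real.rpow_pos_of_pos (by linarith) _
  have hκ₁0 : 0 < κ₁ := mul_pos hκ (Real.rpow_pos_of_pos (by positivity) _)
  have hκ₂0 : 0 < κ₂ := by positivity
  refine ⟨min κ₁ κ₂, lt_min hκ₁0 hκ₂0, fun t => ?_⟩
  have hm0 : 0 ≤ min 1 |t| := le_min zero_le_one (abs_nonneg t)
  have hm1 : min 1 |t| ≤ 1 := min_le_left _ _
  rw [Real.rpow_two]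
  rcases le_total (1 / (2 * Y)) |t| with h | h
  · refine le_trans ?_ (hκt t)
    have h1 : (1 / (2 * Y)) ≤ min 1 |t| :=
      le_min (by rw [div_le_one (by linarith)]; linarith) h
    have h2 : (1 / (2 * Y)) ^ α ≤ min 1 |t| ^ α :=
      Real.rpow_le_rpow (by positivity) h1 (by linarith)
    calc min κ₁ κ₂ * min 1 |t| ^ 2 ≤ κ₁ * 1 := by
          gcongr
          · exact min_le_left _ _
          · nlinarith
      _ ≤ _ := by rw [mul_one, hκ₁]; gcongr
  · refine le_trans ?_ (hY Y (2 * Y) t le_rfl (by linarith))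
    have h1 : Y * (1 / 8 * t ^ 2) ≤ ∫ y in Y..(2 * Y), (1 - Real.cos (t * y)) := by
      have := intervalIntegral.integral_mono_on (μ := volume) (a := Y) (b := 2 * Y)
        (f := fun _ => 1 / 8 * t ^ 2) (g := fun y => 1 - Real.cos (t * y)) (by linarith)
        (by simp) (Continuous.intervalIntegrable (by fun_prop) _ _) (fun y hy => ?_)
      · simpa [two_mul, mul_left_comm] using this
      · have h3 : |t * y| ≤ 1 := by
          rw [abs_mul, abs_of_nonneg (by linarith [hy.1] : 0 ≤ y)]
          calc |t| * y ≤ (1 / (2 * Y)) * (2 * Y) := by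
                gcongr
                · linarith [hy.1]
                · exact hy.2
            _ = 1 := by field_simp
        rcases eq_or_ne t 0 with rfl | ht
        · simp
        · have h4 := fejer_lower (a := y) (t := t) ht (by rwa [mul_comm])
          rw [fejer, le_div_iff₀ (by positivity), mul_comm y t] at h4
          refine le_trans ?_ h4
          have : 1 ≤ y ^ 2 := by nlinarith [hy.1]
          nlinarith [sq_nonneg t]
    calc min κ₁ κ₂ * min 1 |t| ^ 2 ≤ κ₂ * |t| ^ 2 := by
          gcongr
          · exact min_le_right _ _
          · exact min_le_right _ _
      _ = c / 4 * (2 * Y) ^ (-1 - α) * (Y * (1 / 8 * t ^ 2)) := by rw [sq_abs, hκ₂]; ring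
      _ ≤ _ := by gcongr

theorem integrable_abs_rpow_mul_symDensity (hv : IsTailDensity α c v) {b : ℝ}
    (hb0 : 0 < b) (hb : b < α) : Integrable fun y => |y| ^ b * symDensity v y := by
  obtain ⟨C, hC, ⟨M, hM⟩, -, h⟩ := hv.tail
  have hM0 : 0 ≤ M := (hC 0 le_rfl).le.trans (hM ⟨0, Set.self_mem_Ici, rfl⟩)
  have hw := hv.measurable_symDensity
  -- The tail of the integrand is comparable to this power, integrable because its exponent 1 + α -
  -- b exceeds 1.
  have hI : Integrable fun y : ℝ => (1 + ‖y‖) ^ (-(1 + α - b)) :=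
    integrable_one_add_norm (by simp; linarith)
  refine (hv.integrable_symDensity.add (hI.const_mul (M * 2 ^ (1 + α - b)))).mono'
    (by fun_prop) (ae_of_all _ fun y => ?_)
  have hw0 := hv.symDensity_nonneg y
  have hy0 := abs_nonneg y
  rw [Real.norm_of_nonneg (mul_nonneg (Real.rpow_nonneg hy0 _) hw0)]
  have hr : 0 ≤ (1 + ‖y‖) ^ (-(1 + α - b)) := by positivity
  simp only [Pi.add_apply]
  rcases le_total |y| 1 with h1 | h1
  · have := Real.rpow_le_one hy0 h1 hb0.le
    have : 0 ≤ M * 2 ^ (1 + α - b) * (1 + ‖y‖) ^ (-(1 + α - b)) := by positivity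
    nlinarith
  · have hy : 0 < |y| := by linarith
    have h2 : |y| ^ (-(1 + α - b)) ≤ 2 ^ (1 + α - b) * (1 + ‖y‖) ^ (-(1 + α - b)) := by
      rw [Real.rpow_neg hy0, Real.rpow_neg (by positivity), ← div_eq_mul_inv,
        le_div_iff₀ (by positivity), inv_mul_le_iff₀ (Real.rpow_pos_of_pos hy _),
        ← Real.mul_rpow hy0 zero_le_two, Real.norm_eq_abs]
      exact Real.rpow_le_rpow (by positivity) (by linarith) (by linarith)
    have h3 : |y| ^ b * symDensity v y = (1 / 2) * C |y| * |y| ^ (-(1 + α - b)) := by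
      rw [symDensity, h _ hy, show -(1 + α - b) = b + (-1 - α) by ring, Real.rpow_add hy]
      ring
    have h4 : C |y| ≤ M := hM ⟨|y|, hy0, rfl⟩
    have h5 := (hC |y| hy0).le
    have h6 : 0 ≤ |y| ^ (-(1 + α - b)) := Real.rpow_nonneg hy0 _
    rw [h3]
    calc (1 / 2) * C |y| * |y| ^ (-(1 + α - b)) ≤ M * |y| ^ (-(1 + α - b)) := by
          gcongr; linarith
      _ ≤ M * (2 ^ (1 + α - b) * (1 + ‖y‖) ^ (-(1 + α - b))) := by gcongr
      _ ≤ _ := by rw [← mul_assoc]; linarith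

/-- `1 - cos u ≤ 2|u|^b` is integrated against the finite `b`-th moment. Requiring b < α strictly
avoids the logarithm at α = 2; the loss is harmless since the moment thresholds are strict. -/
theorem exists_one_sub_cosTransform_le (hv : IsTailDensity α c v) {b : ℝ}
    (hb0 : 0 < b) (hb : b < α) (hb2 : b ≤ 2) :
    ∃ M : ℝ, 0 < M ∧ ∀ t, 1 - cosTransform (incrementLaw v) t ≤ M * |t| ^ b := by
  have hI := hv.integrable_abs_rpow_mul_symDensity hb0 hb
  have hnn : 0 ≤ ∫ y, |y| ^ b * symDensity v y := integral_nonneg fun y =>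
    mul_nonneg (Real.rpow_nonneg (abs_nonneg y) _) (hv.symDensity_nonneg y)
  refine ⟨2 * (∫ y, |y| ^ b * symDensity v y) + 1, by linarith, fun t => ?_⟩
  have ht : 0 ≤ |t| ^ b := Real.rpow_nonneg (abs_nonneg t) _
  calc 1 - cosTransform (incrementLaw v) t
      ≤ ∫ y, 2 * |t| ^ b * (|y| ^ b * symDensity v y) := by
        rw [hv.one_sub_cosTransform]
        refine integral_mono (hv.integrable_symDensity_mul_one_sub_cos t) (hI.const_mul _)
          fun y => ?_
        have h1 := one_sub_cos_le_two_mul_rpow hb2 hb0 (t * y)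
        rw [abs_mul, Real.mul_rpow (abs_nonneg t) (abs_nonneg y)] at h1
        have := mul_le_mul_of_nonneg_left h1 (hv.symDensity_nonneg y)
        dsimp only
        linarith
    _ ≤ _ := by rw [integral_const_mul]; nlinarith

end IsTailDensity

/-! ### The discounted potential -/

/-- The spectral density of the discounted potential with discount factor `s`. -/
noncomputable def potentialWeight (a : ℝ) (φ : ℝ → ℝ) (s t : ℝ) : ℝ :=
  fejer a t / (1 - s * φ t)

/-- The `s`-discounted potential of the walk with symbol `φ`, applied to the cosine transform of
the Fejér kernel. -/
noncomputable def potential (a : ℝ) (φ : ℝ → ℝ) (s y : ℝ) : ℝ :=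
  ∫ t, potentialWeight a φ s t * Real.cos (t * y)

section Basic

variable {a s : ℝ} {φ : ℝ → ℝ}

theorem one_sub_le_one_sub_mul {x : ℝ} (hs : 0 ≤ s) (hx : x ≤ 1) : 1 - s ≤ 1 - s * x := by
  nlinarith

theorem potentialWeight_nonneg (hs : 0 ≤ s) (hs1 : s < 1) (hφ : ∀ t, |φ t| ≤ 1) (t : ℝ) :
    0 ≤ potentialWeight a φ s t :=
  div_nonneg (fejer_nonneg a t)
    (by linarith [one_sub_le_one_sub_mul hs ((le_abs_self _).trans (hφ t))])

theorem measurable_potentialWeight (hφm : Measurable φ) :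
    Measurable (potentialWeight a φ s) := by
  have := measurable_fejer a
  unfold potentialWeight
  fun_prop

theorem integrable_potentialWeight (hφm : Measurable φ) (hs : 0 ≤ s) (hs1 : s < 1)
    (hφ : ∀ t, |φ t| ≤ 1) : Integrable (potentialWeight a φ s) := by
  refine ((integrable_fejer a).div_const (1 - s)).mono'
    (measurable_potentialWeight hφm).aestronglyMeasurable (ae_of_all _ fun t => ?_)
  rw [Real.norm_of_nonneg (potentialWeight_nonneg hs hs1 hφ t)]
  exact div_le_div_of_nonneg_left (fejer_nonneg a t) (by linarith)
    (one_sub_le_one_sub_mul hs ((le_abs_self _).trans (hφ t)))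

theorem integrable_potentialWeight_mul_cos (hφm : Measurable φ) (hs : 0 ≤ s) (hs1 : s < 1)
    (hφ : ∀ t, |φ t| ≤ 1) (y : ℝ) :
    Integrable fun t => potentialWeight a φ s t * Real.cos (t * y) :=
  (integrable_potentialWeight hφm hs hs1 hφ).mul_bdd (c := 1) (by fun_prop)
    (ae_of_all _ fun _ => Real.abs_cos_le_one _)

theorem continuous_potential (hφm : Measurable φ) (hs : 0 ≤ s) (hs1 : s < 1)
    (hφ : ∀ t, |φ t| ≤ 1) : Continuous (potential a φ s) := by
  refine continuous_of_dominated (bound := potentialWeight a φ s)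
    (fun y => (integrable_potentialWeight_mul_cos hφm hs hs1 hφ y).aestronglyMeasurable)
    (fun y => ae_of_all _ fun t => ?_) (integrable_potentialWeight hφm hs hs1 hφ)
    (ae_of_all _ fun t => by fun_prop)
  have h := potentialWeight_nonneg (a := a) hs hs1 hφ t
  rw [norm_mul, Real.norm_of_nonneg h]
  exact mul_le_of_le_one_right h (Real.abs_cos_le_one _)

theorem potential_zero : potential a φ s 0 = ∫ t, potentialWeight a φ s t := by
  simp [potential]

theorem potential_zero_sub (hφm : Measurable φ) (hs : 0 ≤ s) (hs1 : s < 1)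
    (hφ : ∀ t, |φ t| ≤ 1) (y : ℝ) :
    potential a φ s 0 - potential a φ s y
      = ∫ t, potentialWeight a φ s t * (1 - Real.cos (t * y)) := by
  rw [potential_zero, potential, ← integral_sub (integrable_potentialWeight hφm hs hs1 hφ)
    (integrable_potentialWeight_mul_cos hφm hs hs1 hφ y)]
  simp only [mul_sub, mul_one]

theorem integrable_potentialWeight_mul_one_sub_cos (hφm : Measurable φ) (hs : 0 ≤ s) (hs1 : s < 1)
    (hφ : ∀ t, |φ t| ≤ 1) (y : ℝ) :
    Integrable fun t => potentialWeight a φ s t * (1 - Real.cos (t * y)) := by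
  simp only [mul_sub, mul_one]
  exact (integrable_potentialWeight hφm hs hs1 hφ).sub
    (integrable_potentialWeight_mul_cos hφm hs hs1 hφ y)

theorem potential_le (hφm : Measurable φ) (hs : 0 ≤ s) (hs1 : s < 1)
    (hφ : ∀ t, |φ t| ≤ 1) (y : ℝ) : potential a φ s y ≤ potential a φ s 0 := by
  rw [← sub_nonneg, potential_zero_sub hφm hs hs1 hφ]
  exact integral_nonneg fun t => mul_nonneg (potentialWeight_nonneg hs hs1 hφ t)
    (by linarith [Real.cos_le_one (t * y)])

theorem abs_potential_le (hφm : Measurable φ) (hs : 0 ≤ s) (hs1 : s < 1)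
    (hφ : ∀ t, |φ t| ≤ 1) (y : ℝ) : |potential a φ s y| ≤ potential a φ s 0 := by
  rw [potential_zero]
  rw [potential, ← Real.norm_eq_abs]
  refine norm_integral_le_of_norm_le (integrable_potentialWeight hφm hs hs1 hφ)
    (ae_of_all _ fun t => ?_)
  have h := potentialWeight_nonneg (a := a) hs hs1 hφ t
  rw [norm_mul, Real.norm_of_nonneg h]
  exact mul_le_of_le_one_right h (Real.abs_cos_le_one _)

end Basic

/-! ### The resolvent equation -/

section Invariance

variable {ν : Measure ℝ} [IsProbabilityMeasure ν]

theorem measurable_cosTransform : Measurable (cosTransform ν) := by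
  refine (continuous_of_dominated (bound := fun _ => 1) (fun t => ?_)
    (fun t => ae_of_all _ fun y => Real.abs_cos_le_one _) (integrable_const _)
    (ae_of_all _ fun y => ?_)).measurable
  · exact Continuous.aestronglyMeasurable (by fun_prop)
  · fun_prop

/-- Cosines are eigenfunctions of the transition operator, the sine part being killed by symmetry.
-/
theorem integral_cos_add (hsin : ∀ t, ∫ y, Real.sin (t * y) ∂ν = 0) (t y : ℝ) :
    ∫ z, Real.cos (t * (y + z)) ∂ν = Real.cos (t * y) * cosTransform ν t := by
  simp only [mul_add, Real.cos_add]
  rw [integral_sub, integral_const_mul, integral_const_mul, hsin, mul_zero, sub_zero,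
    cosTransform]
  · exact (Integrable.of_bound (by fun_prop) 1
      (ae_of_all _ fun y => Real.abs_cos_le_one _)).const_mul _
  · exact (Integrable.of_bound (by fun_prop) 1
      (ae_of_all _ fun y => Real.abs_sin_le_one _)).const_mul _

/-- The resolvent equation: the discounted potential solves the Poisson equation of the walk. -/
theorem potential_sub_mul_integral (hsin : ∀ t, ∫ y, Real.sin (t * y) ∂ν = 0) {a s : ℝ}
    (hs : 0 ≤ s) (hs1 : s < 1) (y : ℝ) :
    potential a (cosTransform ν) s y - s * ∫ z, potential a (cosTransform ν) s (y + z) ∂ν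
      = ∫ t, fejer a t * Real.cos (t * y) := by
  have hφ : ∀ t, |cosTransform ν t| ≤ 1 := abs_cosTransform_le
  have hφm : Measurable (cosTransform ν) := measurable_cosTransform
  have hW := integrable_potentialWeight (a := a) hφm hs hs1 hφ
  have h1 : ∫ z, potential a (cosTransform ν) s (y + z) ∂ν
      = ∫ t, potentialWeight a (cosTransform ν) s t * (Real.cos (t * y) * cosTransform ν t) := by
    simp only [potential]
    rw [integral_integral_swap]
    · simp only [integral_const_mul, integral_cos_add hsin]
    · have hsnd : Integrable (fun p : ℝ × ℝ => potentialWeight a (cosTransform ν) s p.2)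
          (ν.prod volume) := hW.comp_snd ν
      exact hsnd.mul_bdd (c := 1) (Continuous.aestronglyMeasurable (by fun_prop))
        (ae_of_all _ fun p => Real.abs_cos_le_one _)
  have hI : Integrable fun t =>
      potentialWeight a (cosTransform ν) s t * (Real.cos (t * y) * cosTransform ν t) := by
    refine hW.mul_bdd (c := 1) (by fun_prop) (ae_of_all _ fun t => ?_)
    rw [norm_mul]
    exact mul_le_one₀ (Real.abs_cos_le_one _) (norm_nonneg _) (hφ t)
  rw [h1, potential, ← integral_const_mul,
    ← integral_sub (integrable_potentialWeight_mul_cos hφm hs hs1 hφ y) (hI.const_mul s)]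
  -- The factor 1 - sφ(t) produced by the subtraction cancels the denominator of the weight.
  refine integral_congr_ae (ae_of_all _ fun t => ?_)
  have h2 : 1 - s * cosTransform ν t ≠ 0 := by
    have := one_sub_le_one_sub_mul hs ((le_abs_self _).trans (hφ t))
    linarith
  simp only [potentialWeight]
  field_simp

end Invariance

/-! ### Size of the potential as s → 1 -/

section Bounds

variable {a s κ β : ℝ} {φ : ℝ → ℝ}

theorem mul_sub_le_integral {f : ℝ → ℝ} (hf : Integrable f) (hf0 : ∀ t, 0 ≤ f t) {l r k : ℝ}
    (hlr : l ≤ r) (h : ∀ t, l < t → t ≤ r → k ≤ f t) : k * (r - l) ≤ ∫ t, f t := by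
  refine le_trans ?_ (setIntegral_le_integral (s := Set.Ioc l r) hf (ae_of_all _ hf0))
  have := setIntegral_mono_on (μ := volume) (s := Set.Ioc l r) (f := fun _ => k) (g := f)
    (by simp) hf.integrableOn measurableSet_Ioc fun t ht => h t ht.1 ht.2
  simpa [hlr, mul_comm] using this

/-- 1 - sφ ≥ s(1 - φ), with s ≥ 1/2: a bound uniform in s. -/
theorem mul_min_rpow_le_one_sub_mul (hκ : 0 < κ)
    (hL : ∀ t, κ * min 1 |t| ^ β ≤ 1 - φ t) (hs : 1 / 2 ≤ s) (hs1 : s < 1) (t : ℝ) :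
    κ / 2 * min 1 |t| ^ β ≤ 1 - s * φ t := by
  have h0 : 0 ≤ min 1 |t| ^ β := Real.rpow_nonneg (le_min zero_le_one (abs_nonneg t)) _
  have h1 := hL t
  have h2 : 0 ≤ κ * min 1 |t| ^ β := by positivity
  nlinarith

/-- The quadratic zero of 1 - cos(ty) at t = 0 absorbs the singularity of the weight, of order at
most β ≤ 2, so the bound does not depend on s. -/
theorem potential_zero_sub_le (hφm : Measurable φ) (hφ : ∀ t, |φ t| ≤ 1) (hκ : 0 < κ)
    (hβ : β ≤ 2) (hL : ∀ t, κ * min 1 |t| ^ β ≤ 1 - φ t) (hs : 1 / 2 ≤ s)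
    (hs1 : s < 1) (y : ℝ) :
    potential a φ s 0 - potential a φ s y ≤ (4 / κ * ∫ t, fejer a t) * (1 + y ^ 2) := by
  have hs0 : 0 ≤ s := by linarith
  rw [potential_zero_sub hφm hs0 hs1 hφ, mul_right_comm, ← integral_const_mul]
  refine integral_mono (integrable_potentialWeight_mul_one_sub_cos hφm hs0 hs1 hφ y)
    ((integrable_fejer a).const_mul _) fun t => ?_
  have hK := fejer_nonneg a t
  rcases eq_or_ne t 0 with rfl | ht
  · simp only [zero_mul, Real.cos_zero, sub_self, mul_zero]
    positivity
  have hm0 : 0 < min 1 |t| := lt_min one_pos (abs_pos.2 ht)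
  have h1 := mul_min_rpow_le_one_sub_mul hκ hL hs hs1 t
  have h2 : min 1 |t| ^ (2 : ℝ) ≤ min 1 |t| ^ β :=
    Real.rpow_le_rpow_of_exponent_ge hm0 (min_le_left _ _) hβ
  rw [Real.rpow_two] at h2
  have h3 : 1 - Real.cos (t * y) ≤ 2 * (1 + y ^ 2) * min 1 |t| ^ 2 := by
    rcases le_total 1 |t| with h | h
    · rw [min_eq_left h]
      nlinarith [Real.neg_one_le_cos (t * y), sq_nonneg y]
    · rw [min_eq_right h, sq_abs]
      nlinarith [Real.one_sub_sq_div_two_le_cos (x := t * y), sq_nonneg t, sq_nonneg (t * y)]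
  have hD : 0 < 1 - s * φ t := by
    have := one_sub_le_one_sub_mul hs0 ((le_abs_self _).trans (hφ t))
    linarith
  simp only [potentialWeight]
  rw [div_mul_eq_mul_div, div_le_iff₀ hD]
  calc fejer a t * (1 - Real.cos (t * y)) ≤ fejer a t * (2 * (1 + y ^ 2) * min 1 |t| ^ 2) := by
        gcongr
    _ = 4 / κ * (1 + y ^ 2) * fejer a t * (κ / 2 * min 1 |t| ^ 2) := by field_simp; ring
    _ ≤ 4 / κ * (1 + y ^ 2) * fejer a t * (κ / 2 * min 1 |t| ^ β) := by gcongr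
    _ ≤ _ := by gcongr

theorem integrable_fejer_mul_min_rpow {r : ℝ} (hr : r < 1) :
    Integrable fun t => fejer a t * min 1 |t| ^ (-r) := by
  have h1 : IntegrableOn (fun t : ℝ => |t| ^ (-r)) (Set.Icc (-1) 1) := by
    have h2 : IntervalIntegrable (fun t : ℝ => |t| ^ (-r)) volume 0 1 :=
      (intervalIntegral.intervalIntegrable_rpow' (by linarith : -1 < -r)).congr
        fun t ht => by
          rw [Set.uIoc_of_le zero_le_one] at ht
          simp only [abs_of_pos ht.1]
    have h3 : IntervalIntegrable (fun t : ℝ => |t| ^ (-r)) volume (-1) 0 := by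
      have := (IntervalIntegrable.iff_comp_neg).1 h2
      simpa using this.symm
    rw [integrableOn_Icc_iff_integrableOn_Ioc,
      ← intervalIntegrable_iff_integrableOn_Ioc_of_le (by norm_num)]
    exact h3.trans h2
  have hm := measurable_fejer a
  refine ((integrable_fejer a).add ((h1.integrable_indicator measurableSet_Icc).const_mul
    (a ^ 2 / 2))).mono' (by fun_prop) (ae_of_all _ fun t => ?_)
  have hK := fejer_nonneg a t
  have hp : 0 ≤ min 1 |t| ^ (-r) := Real.rpow_nonneg (le_min zero_le_one (abs_nonneg t)) _
  rw [Real.norm_of_nonneg (by positivity)]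
  simp only [Pi.add_apply]
  rcases le_total 1 |t| with h | h
  · rw [min_eq_left h, Real.one_rpow, mul_one]
    have : 0 ≤ (Set.Icc (-1) 1).indicator (fun t : ℝ => |t| ^ (-r)) t :=
      Set.indicator_nonneg (fun t _ => Real.rpow_nonneg (abs_nonneg t) _) t
    nlinarith [sq_nonneg a]
  · rw [min_eq_right h] at hp ⊢
    rw [Set.indicator_of_mem (show t ∈ Set.Icc (-1) 1 from abs_le.1 h)]
    nlinarith [fejer_le a t]

theorem potential_zero_le (hφm : Measurable φ) (hφ : ∀ t, |φ t| ≤ 1) (hκ : 0 < κ)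
    (hL : ∀ t, κ * min 1 |t| ^ β ≤ 1 - φ t) {θ : ℝ} (hθ0 : 0 ≤ θ) (hθ1 : θ ≤ 1)
    (hθ : β * θ < 1) (hs : 1 / 2 ≤ s) (hs1 : s < 1) :
    potential a φ s 0 ≤ ((κ / 2) ^ (-θ) * ∫ t, fejer a t * min 1 |t| ^ (-(β * θ)))
      * (1 - s) ^ (θ - 1) := by
  have hs0 : 0 ≤ s := by linarith
  rw [potential_zero, mul_right_comm, ← integral_const_mul]
  refine integral_mono_ae (integrable_potentialWeight hφm hs0 hs1 hφ)
    ((integrable_fejer_mul_min_rpow hθ).const_mul _) ?_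
  filter_upwards [compl_mem_ae_iff.2 (measure_singleton (0 : ℝ))] with t ht
  have ht : t ≠ 0 := ht
  have hm0 : 0 < min 1 |t| := lt_min one_pos (abs_pos.2 ht)
  have h1 := mul_min_rpow_le_one_sub_mul hκ hL hs hs1 t
  have h2 := one_sub_le_one_sub_mul hs0 ((le_abs_self _).trans (hφ t))
  have hD : 0 < 1 - s * φ t := by linarith
  have hb : 0 < min 1 |t| ^ β := Real.rpow_pos_of_pos hm0 _
  -- The geometric mean, with weights θ and 1 - θ, of the two lower bounds for 1 - sφ. It leaves the
  -- singularity |t|^(-βθ), integrable because βθ < 1.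
  have h3 : (κ / 2 * min 1 |t| ^ β) ^ θ * (1 - s) ^ (1 - θ) ≤ 1 - s * φ t := by
    calc (κ / 2 * min 1 |t| ^ β) ^ θ * (1 - s) ^ (1 - θ)
        ≤ (1 - s * φ t) ^ θ * (1 - s * φ t) ^ (1 - θ) := by
          gcongr
      _ = 1 - s * φ t := by rw [← Real.rpow_add hD]; simp
  have hs' : 0 < 1 - s := by linarith
  calc potentialWeight a φ s t
      ≤ fejer a t / ((κ / 2 * min 1 |t| ^ β) ^ θ * (1 - s) ^ (1 - θ)) :=
        div_le_div_of_nonneg_left (fejer_nonneg a t)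
          (mul_pos (Real.rpow_pos_of_pos (by positivity) _) (Real.rpow_pos_of_pos hs' _)) h3
    _ = _ := by
        rw [Real.mul_rpow (by positivity) hb.le, ← Real.rpow_mul hm0.le,
          Real.rpow_neg (by positivity), Real.rpow_neg hm0.le,
          show θ - 1 = -(1 - θ) by ring, Real.rpow_neg hs'.le, div_eq_mul_inv, mul_inv, mul_inv]
        ring

/-- For 0 < t ≤ (1-s)^(1/b) the denominator is at most (1+M)(1-s), so this interval alone yields the
bound; `hsa` keeps `a * t ≤ 1` there. -/
theorem potential_zero_ge (hφm : Measurable φ) (hφ : ∀ t, |φ t| ≤ 1) (ha : 0 < a) {b M : ℝ}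
    (hM : 0 < M) (hb : 0 < b) (hU : ∀ t, 1 - φ t ≤ M * |t| ^ b) (hs : 0 ≤ s) (hs1 : s < 1)
    (hsa : (1 - s) ^ (1 / b) ≤ 1 / a) :
    a ^ 2 / 8 / (1 + M) * (1 - s) ^ (1 / b - 1) ≤ potential a φ s 0 := by
  have hs' : 0 < 1 - s := by linarith
  have h := mul_sub_le_integral (integrable_potentialWeight (a := a) hφm hs hs1 hφ)
    (potentialWeight_nonneg hs hs1 hφ) (l := 0) (r := (1 - s) ^ (1 / b))
    (k := a ^ 2 / 8 / ((1 + M) * (1 - s))) (Real.rpow_nonneg hs'.le _) (fun t ht htr => ?_)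
  · rw [potential_zero]
    refine le_trans (le_of_eq ?_) h
    rw [Real.rpow_sub_one hs'.ne']
    field_simp
    simp
  · have hD := one_sub_le_one_sub_mul hs ((le_abs_self _).trans (hφ t))
    have h1 : |t| ^ b ≤ 1 - s := by
      rw [abs_of_pos ht]
      calc t ^ b ≤ ((1 - s) ^ (1 / b)) ^ b := by gcongr
        _ = 1 - s := by rw [← Real.rpow_mul hs'.le, one_div_mul_cancel hb.ne', Real.rpow_one]
    refine div_le_div₀ (fejer_nonneg a t) (fejer_lower ht.ne' ?_) (by linarith) ?_
    · rw [abs_of_pos (by positivity)]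
      calc a * t ≤ a * (1 / a) := by gcongr; exact htr.trans hsa
        _ = 1 := by field_simp
    · have h2 := hU t
      have h3 : M * |t| ^ b ≤ M * (1 - s) := by gcongr
      have h4 : s * (1 - φ t) ≤ 1 * (1 - φ t) := by
        gcongr
        linarith [(le_abs_self _).trans (hφ t)]
      nlinarith

/-- On 1/R < t ≤ 3/(2R) one has 1 ≤ ty ≤ 3 < π, so 1 - cos(ty) ≥ 1 - cos 1, while the denominator is
O(R^(-b)). The window has length 1/(2R), so its contribution is of order R^(b-1), unbounded since b
> 1. -/
theorem exists_le_potential_zero_sub (hφm : Measurable φ) (hφ : ∀ t, |φ t| ≤ 1) (ha : 0 < a)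
    {b M : ℝ} (hM : 0 < M) (hb : 1 < b) (hb2 : b ≤ 2) (hU : ∀ t, 1 - φ t ≤ M * |t| ^ b)
    (B R₀ : ℝ) :
    ∃ R s₀ : ℝ, R₀ ≤ R ∧ s₀ < 1 ∧ ∀ s y, s₀ ≤ s → 0 ≤ s → s < 1 → R ≤ y → y ≤ R + 1 →
      B ≤ potential a φ s 0 - potential a φ s y := by
  have hcos1 : 0 < 1 - Real.cos 1 := by linarith [Real.cos_one_le]
  set k := a ^ 2 / 8 * (1 - Real.cos 1) / (8 * M) with hk
  have hk0 : 0 < k := by positivity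
  have hlim : Tendsto (fun R : ℝ => k * R ^ (b - 1)) atTop atTop :=
    (tendsto_rpow_atTop (by linarith)).const_mul_atTop hk0
  obtain ⟨R, hRB, hR0, hR1, hRa⟩ := ((hlim.eventually_ge_atTop B).and
    ((eventually_ge_atTop R₀).and ((eventually_ge_atTop 1).and
      (eventually_ge_atTop (3 / 2 * a))))).exists
  have hRpos : 0 < R := by linarith
  have hRb : 0 < R ^ (-b) := Real.rpow_pos_of_pos hRpos _
  -- This `s₀` gives 1 - s ≤ M R^(-b); with M t^b ≤ 3M R^(-b) the denominator is at most 4M R^(-b).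
  refine ⟨R, 1 - M * R ^ (-b), hR0, by nlinarith, fun s y hs hs0 hs1 hy hy1 => ?_⟩
  rw [potential_zero_sub hφm hs0 hs1 hφ]
  have h := mul_sub_le_integral (integrable_potentialWeight_mul_one_sub_cos (a := a) hφm hs0 hs1
    hφ y) (fun t => mul_nonneg (potentialWeight_nonneg hs0 hs1 hφ t)
      (by linarith [Real.cos_le_one (t * y)])) (l := 1 / R) (r := 3 / 2 * (1 / R))
    (k := a ^ 2 / 8 / (4 * (M * R ^ (-b))) * (1 - Real.cos 1)) (by
      have : 0 < 1 / R := by positivity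
      linarith) (fun t ht htr => ?_)
  · refine hRB.trans (le_trans (le_of_eq ?_) h)
    rw [hk, Real.rpow_neg hRpos.le, Real.rpow_sub_one hRpos.ne']
    field_simp
    ring
  · have htp : 0 < t := lt_trans (by positivity) ht
    have hD := one_sub_le_one_sub_mul hs0 ((le_abs_self _).trans (hφ t))
    have h1 : |t| ^ b ≤ 3 * R ^ (-b) := by
      rw [abs_of_pos htp]
      calc t ^ b ≤ (3 / 2 * (1 / R)) ^ b := by gcongr
        _ = (3 / 2) ^ b * R ^ (-b) := by
          rw [Real.mul_rpow (by norm_num) (by positivity), one_div, Real.inv_rpow hRpos.le,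
            Real.rpow_neg hRpos.le]
        _ ≤ 3 * R ^ (-b) := by
          gcongr
          calc (3 / 2 : ℝ) ^ b ≤ (3 / 2) ^ (2 : ℝ) :=
                Real.rpow_le_rpow_of_exponent_le (by norm_num) hb2
            _ ≤ 3 := by norm_num
    refine mul_le_mul ?_ ?_ hcos1.le (potentialWeight_nonneg hs0 hs1 hφ t)
    · refine div_le_div₀ (fejer_nonneg a t) (fejer_lower htp.ne' ?_) (by linarith) ?_
      · rw [abs_of_pos (by positivity)]
        calc a * t ≤ a * (3 / 2 * (1 / R)) := by gcongr
          _ = 3 / 2 * a / R := by ring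
          _ ≤ 1 := by rw [div_le_one hRpos]; exact hRa
      · have h2 := hU t
        have h3 : M * |t| ^ b ≤ M * (3 * R ^ (-b)) := by gcongr
        have h4 : s * (1 - φ t) ≤ 1 * (1 - φ t) := by
          gcongr
          linarith [(le_abs_self _).trans (hφ t)]
        nlinarith
    · have h5 : 1 ≤ t * y := by
        calc (1 : ℝ) = 1 / R * R := by field_simp
          _ ≤ t * y := by gcongr
      have h6 : t * y ≤ 3 := by
        calc t * y ≤ 3 / 2 * (1 / R) * (R + 1) := by
              gcongr
              linarith
          _ = 3 / 2 * ((R + 1) / R) := by ring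
          _ ≤ 3 / 2 * 2 := by
            gcongr
            rw [div_le_iff₀ hRpos]; linarith
          _ = 3 := by norm_num
      have := Real.cos_le_cos_of_nonneg_of_le_pi zero_le_one
        (by linarith [Real.pi_gt_three]) h5
      linarith

end Bounds

/-! ### The passage time and the stopped discounted process -/

section PassageTime

variable {Ω : Type*} {Z : ℕ → Ω → ℝ} {a : ℝ} {ω : Ω}

theorem passageTime_le_iff {n : ℕ} : passageTime Z a ω ≤ n ↔ ∃ j ≤ n, |Z j ω| ≤ a := by
  constructor
  · intro h
    by_contra! hcon
    have h1 : ((n + 1 : ℕ) : ℕ∞) ≤ passageTime Z a ω := by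
      refine le_iInf₂ fun j hj => ?_
      have : n < j := by
        by_contra! hj'
        exact absurd hj (not_le.2 (hcon j hj'))
      exact_mod_cast this
    have h2 : ((n + 1 : ℕ) : ℕ∞) ≤ n := h1.trans h
    have h3 : n + 1 ≤ n := by exact_mod_cast h2
    omega
  · rintro ⟨j, hj, hja⟩
    exact (iInf₂_le j hja).trans (by exact_mod_cast hj)

theorem lt_passageTime_iff {n : ℕ} : n < passageTime Z a ω ↔ ∀ j ≤ n, a < |Z j ω| := by
  rw [← not_le, passageTime_le_iff]
  push Not
  rfl

theorem abs_le_of_passageTime_eq {k : ℕ} (h : passageTime Z a ω = k) : |Z k ω| ≤ a := by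
  obtain ⟨j, hj, hja⟩ := passageTime_le_iff.1 h.le
  have h1 : (k : ℕ∞) ≤ j := h ▸ passageTime_le_iff.2 ⟨j, le_rfl, hja⟩
  have h2 : k ≤ j := by exact_mod_cast h1
  rwa [le_antisymm h2 hj]

theorem passageTime_eq_iff {k : ℕ} :
    passageTime Z a ω = k ↔ |Z k ω| ≤ a ∧ ∀ j < k, a < |Z j ω| := by
  refine ⟨fun h => ⟨abs_le_of_passageTime_eq h, fun j hj => ?_⟩, fun ⟨h1, h2⟩ => ?_⟩
  · have h1 : (j : ℕ∞) < passageTime Z a ω := by rw [h]; exact_mod_cast hj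
    exact lt_passageTime_iff.1 h1 j le_rfl
  · refine le_antisymm (passageTime_le_iff.2 ⟨k, le_rfl, h1⟩) (le_iInf₂ fun j hj => ?_)
    have : k ≤ j := by
      by_contra! hjk
      exact absurd hj (not_le.2 (h2 j hjk))
    exact_mod_cast this

theorem passageTime_eq_top_iff : passageTime Z a ω = ⊤ ↔ ∀ j, a < |Z j ω| := by
  rw [ENat.eq_top_iff_forall_gt]
  exact ⟨fun h j => lt_passageTime_iff.1 (h j) j le_rfl,
    fun h n => lt_passageTime_iff.2 fun j _ => h j⟩

theorem measurable_passageTime [MeasurableSpace Ω] (hZ : ∀ n, Measurable (Z n)) :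
    Measurable (passageTime Z a) := by
  refine measurable_to_countable' fun τ => ?_
  have h : ∀ j, MeasurableSet {ω | a < |Z j ω|} := fun j =>
    measurableSet_lt measurable_const (hZ j).abs
  induction τ using ENat.recTopCoe with
  | top =>
    have : passageTime Z a ⁻¹' {⊤} = ⋂ j, {ω | a < |Z j ω|} := by
      ext ω; simp [passageTime_eq_top_iff]
    exact this ▸ MeasurableSet.iInter h
  | coe k =>
    have : passageTime Z a ⁻¹' {(k : ℕ∞)}
        = {ω | |Z k ω| ≤ a} ∩ ⋂ j, ⋂ (_ : j < k), {ω | a < |Z j ω|} := by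
      ext ω; simp [passageTime_eq_iff]
    exact this ▸ (measurableSet_le (hZ k).abs measurable_const).inter
      (MeasurableSet.iInter fun j => MeasurableSet.iInter fun _ => h j)

/-- The discount factor `s ^ τ`, equal to `0` when `τ = ∞`. -/
noncomputable def discount (Z : ℕ → Ω → ℝ) (a s : ℝ) (ω : Ω) : ℝ :=
  if passageTime Z a ω = ⊤ then 0 else s ^ (passageTime Z a ω).toNat

theorem discount_nonneg {s : ℝ} (hs : 0 ≤ s) : 0 ≤ discount Z a s ω := by
  rw [discount]; split_ifs <;> positivity

theorem discount_le_one {s : ℝ} (hs : 0 ≤ s) (hs1 : s ≤ 1) : discount Z a s ω ≤ 1 := by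
  rw [discount]; split_ifs
  · exact zero_le_one
  · exact pow_le_one₀ hs hs1

theorem measurable_discount [MeasurableSpace Ω] (hZ : ∀ n, Measurable (Z n)) (s : ℝ) :
    Measurable (discount Z a s) :=
  (measurable_of_countable fun τ : ℕ∞ => if τ = ⊤ then (0 : ℝ) else s ^ τ.toNat).comp
    (measurable_passageTime hZ)

/-- The process `s ^ n * G (Z n)` stopped at the passage time. -/
noncomputable def stoppedDiscount (Z : ℕ → Ω → ℝ) (a s : ℝ) (G : ℝ → ℝ) (n : ℕ) (ω : Ω) : ℝ :=
  s ^ (min (n : ℕ∞) (passageTime Z a ω)).toNat *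
    G (Z (min (n : ℕ∞) (passageTime Z a ω)).toNat ω)

variable {s : ℝ} {G : ℝ → ℝ}

theorem stoppedDiscount_of_le {n : ℕ} (h : n ≤ passageTime Z a ω) :
    stoppedDiscount Z a s G n ω = s ^ n * G (Z n ω) := by
  rw [stoppedDiscount, min_eq_left h, ENat.toNat_natCast]

theorem stoppedDiscount_of_ge {n : ℕ} (h : passageTime Z a ω ≤ n) :
    stoppedDiscount Z a s G n ω = discount Z a s ω * G (Z (passageTime Z a ω).toNat ω) := by
  rw [stoppedDiscount, min_eq_right h, discount,
    if_neg (ne_top_of_le_ne_top (ENat.natCast_ne_top n) h)]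

theorem stoppedDiscount_succ_sub (n : ℕ) :
    stoppedDiscount Z a s G (n + 1) ω - stoppedDiscount Z a s G n ω
      = {ω | n < passageTime Z a ω}.indicator
        (fun ω => s ^ n * (s * G (Z (n + 1) ω) - G (Z n ω))) ω := by
  by_cases h : n < passageTime Z a ω
  · rw [Set.indicator_of_mem (show ω ∈ {ω | (n : ℕ∞) < passageTime Z a ω} from h), stoppedDiscount_of_le h.le, stoppedDiscount_of_le]
    · ring
    · exact_mod_cast Order.add_one_le_of_lt h
  · rw [Set.indicator_of_notMem (show ω ∉ {ω | (n : ℕ∞) < passageTime Z a ω} from h), stoppedDiscount_of_ge (not_lt.1 h), stoppedDiscount_of_ge,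
      sub_self]
    exact (not_lt.1 h).trans (by exact_mod_cast n.le_succ)

theorem abs_stoppedDiscount_le (hs : 0 ≤ s) (hs1 : s ≤ 1) {B : ℝ} (hG : ∀ y, |G y| ≤ B) (n : ℕ) :
    |stoppedDiscount Z a s G n ω| ≤ B := by
  rw [stoppedDiscount, abs_mul, abs_of_nonneg (pow_nonneg hs _)]
  exact (mul_le_of_le_one_left (abs_nonneg _) (pow_le_one₀ hs hs1)).trans (hG _)

/-- If τ = ∞ then s^n times a bounded quantity tends to 0; the limit agrees because `discount`
vanishes there, whatever position `toNat ⊤ = 0` selects. -/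
theorem tendsto_stoppedDiscount (hs : 0 ≤ s) (hs1 : s < 1) {B : ℝ} (hG : ∀ y, |G y| ≤ B) :
    Tendsto (fun n => stoppedDiscount Z a s G n ω) atTop
      (𝓝 (discount Z a s ω * G (Z (passageTime Z a ω).toNat ω))) := by
  by_cases h : passageTime Z a ω = ⊤
  · rw [discount, if_pos h, zero_mul]
    refine squeeze_zero_norm (a := fun n => s ^ n * B) (fun n => ?_) ?_
    · rw [stoppedDiscount_of_le (by simp [h]), norm_mul,
        Real.norm_of_nonneg (pow_nonneg hs _)]
      exact mul_le_mul_of_nonneg_left (hG _) (pow_nonneg hs _)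
    · simpa using (tendsto_pow_atTop_nhds_zero_of_lt_one hs hs1).mul_const B
  · obtain ⟨k, hk⟩ := ENat.ne_top_iff_exists.1 h
    refine tendsto_const_nhds.congr' ?_
    filter_upwards [eventually_ge_atTop k] with n hn
    rw [stoppedDiscount_of_ge]
    rw [← hk]
    exact_mod_cast hn

theorem measurable_stoppedDiscount [MeasurableSpace Ω] (hZ : ∀ n, Measurable (Z n))
    (hG : Measurable G) (n : ℕ) : Measurable (stoppedDiscount Z a s G n) := by
  have h1 : Measurable fun p : ℕ × Ω => s ^ p.1 * G (Z p.1 p.2) :=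
    measurable_from_prod_countable_right fun k => (hG.comp (hZ k)).const_mul (s ^ k)
  have h2 : Measurable fun ω => (min (n : ℕ∞) (passageTime Z a ω)).toNat :=
    (measurable_of_countable fun τ : ℕ∞ => (min (n : ℕ∞) τ).toNat).comp (measurable_passageTime hZ)
  exact h1.comp (h2.prodMk measurable_id)

end PassageTime

/-! ### Events known at time n -/

section History

variable {Ω : Type*}

/-- The history of the process `Z` up to time `n`. -/
abbrev history (Z : ℕ → Ω → ℝ) (n : ℕ) : MeasurableSpace Ω :=
  ⨆ k ≤ n, MeasurableSpace.comap (Z k) inferInstance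

theorem history_mono (Z : ℕ → Ω → ℝ) : Monotone (history Z) := fun _ _ h =>
  iSup₂_le fun k hk => le_iSup₂_of_le (f := fun k _ => MeasurableSpace.comap (Z k) inferInstance)
    k (hk.trans h) le_rfl

theorem measurable_history (Z : ℕ → Ω → ℝ) {k n : ℕ} (h : k ≤ n) :
    Measurable[history Z n] (Z k) :=
  (comap_measurable (Z k)).mono
    (le_iSup₂_of_le (f := fun k _ => MeasurableSpace.comap (Z k) inferInstance) k h le_rfl) le_rfl

theorem measurableSet_history_lt_passageTime (Z : ℕ → Ω → ℝ) (a : ℝ) (n : ℕ) :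
    MeasurableSet[history Z n] {ω | n < passageTime Z a ω} := by
  have h : {ω | n < passageTime Z a ω} = ⋂ j, ⋂ (_ : j ≤ n), Z j ⁻¹' {y | a < |y|} := by
    ext ω
    simp [lt_passageTime_iff]
  rw [h]
  exact MeasurableSet.iInter fun j => MeasurableSet.iInter fun hj =>
    measurable_history Z hj (measurableSet_lt measurable_const measurable_id.abs)

theorem history_le [MeasurableSpace Ω] {Z : ℕ → Ω → ℝ} (hZ : ∀ n, Measurable (Z n)) (n : ℕ) : history Z n ≤ ‹MeasurableSpace Ω› :=
  iSup₂_le fun k _ => (hZ k).comap_le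

end History

/-! ### The Markov property and optional stopping -/

section Walk

variable {Ω : Type*} [MeasurableSpace Ω] {P : Measure Ω} {v : ℝ → ℝ}
  {x : ℝ} {Z : ℕ → Ω → ℝ}

namespace IsRandomWalk

/-- The Markov property as a convolution: after the shift by `Z n`, the kernel in `markov` is the
translated increment law. This carries it from sets to functions. -/
theorem map_restrict_succ [IsFiniteMeasure P] (hZ : IsRandomWalk P (symDensity v) x Z)
    [SFinite (incrementLaw v)] {n : ℕ} {A : Set Ω}
    (hA : MeasurableSet[history Z n] A) :
    (P.restrict A).map (Z (n + 1)) = ((P.restrict A).map (Z n)).conv (incrementLaw v) := by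
  ext B hB
  rw [Measure.map_apply (hZ.measurable _) hB,
    Measure.restrict_apply ((hZ.measurable _) hB), Set.inter_comm, hZ.markov n A hA B hB,
    Measure.conv, Measure.map_apply measurable_add hB,
    Measure.prod_apply (measurable_add hB), lintegral_map
      (measurable_measure_prodMk_left (measurable_add hB)) (hZ.measurable n)]
  refine lintegral_congr fun ω => ?_
  have h : MeasurableSet (Prod.mk (Z n ω) ⁻¹' ((fun p : ℝ × ℝ => p.1 + p.2) ⁻¹' B)) :=
    measurable_prodMk_left (measurable_add hB)
  rw [incrementLaw, withDensity_apply _ h, ← lintegral_indicator hB, ← lintegral_indicator h,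
    eq_comm, ← lintegral_sub_right_eq_self _ (Z n ω)]
  refine lintegral_congr fun z => ?_
  have hz : z - Z n ω ∈ Prod.mk (Z n ω) ⁻¹' ((fun p : ℝ × ℝ => p.1 + p.2) ⁻¹' B) ↔ z ∈ B := by
    change Z n ω + (z - Z n ω) ∈ B ↔ z ∈ B
    rw [add_sub_cancel]
  by_cases hzB : z ∈ B
  · rw [Set.indicator_of_mem hzB, Set.indicator_of_mem (hz.2 hzB)]
  · rw [Set.indicator_of_notMem hzB, Set.indicator_of_notMem (mt hz.1 hzB)]

theorem setIntegral_succ [IsFiniteMeasure P] (hZ : IsRandomWalk P (symDensity v) x Z)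
    [IsFiniteMeasure (incrementLaw v)] {n : ℕ} {A : Set Ω}
    (hA : MeasurableSet[history Z n] A) {f : ℝ → ℝ} (hf : Measurable f) {B : ℝ}
    (hB : ∀ y, |f y| ≤ B) :
    ∫ ω in A, f (Z (n + 1) ω) ∂P = ∫ ω in A, ∫ z, f (Z n ω + z) ∂(incrementLaw v) ∂P := by
  rw [← integral_map (hZ.measurable (n + 1)).aemeasurable hf.aestronglyMeasurable,
    hZ.map_restrict_succ hA, Measure.conv,
    integral_map measurable_add.aemeasurable hf.aestronglyMeasurable, integral_prod,
    integral_map (hZ.measurable n).aemeasurable]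
  · exact (StronglyMeasurable.integral_prod_right
      (f := fun y z : ℝ => f (y + z)) (hf.comp measurable_add).stronglyMeasurable).aestronglyMeasurable
  · exact Integrable.of_bound (hf.comp measurable_add).aestronglyMeasurable B
      (ae_of_all _ fun p => hB _)

variable [IsProbabilityMeasure P] {α c a s : ℝ}

/-- Optional stopping for the discounted potential of the walk. -/
theorem setIntegral_stoppedDiscount (hZ : IsRandomWalk P (symDensity v) x Z)
    (hv : IsTailDensity α c v) (ha : 0 < a) (hs : 0 ≤ s) (hs1 : s < 1) {m : ℕ} {D : Set Ω}
    (hD : MeasurableSet[history Z m] D) :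
    ∫ ω in D, stoppedDiscount Z a s (potential a (cosTransform (incrementLaw v)) s) m ω ∂P
      = ∫ ω in D, discount Z a s ω * potential a (cosTransform (incrementLaw v)) s
        (Z (passageTime Z a ω).toNat ω) ∂P := by
  have := hv.isProbabilityMeasure_incrementLaw
  set G := potential a (cosTransform (incrementLaw v)) s with hG
  have hφ : ∀ t, |cosTransform (incrementLaw v) t| ≤ 1 := abs_cosTransform_le
  have hφm : Measurable (cosTransform (incrementLaw v)) := measurable_cosTransform
  have hGm : Measurable G := (continuous_potential hφm hs hs1 hφ).measurable
  have hGB : ∀ y, |G y| ≤ G 0 := abs_potential_le hφm hs hs1 hφ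
  have hYm := fun n => measurable_stoppedDiscount (a := a) (s := s) hZ.measurable hGm n
  have hYI : ∀ n, Integrable (stoppedDiscount Z a s G n) (P.restrict D) := fun n =>
    Integrable.of_bound (hYm n).aestronglyMeasurable (G 0)
      (ae_of_all _ fun ω => abs_stoppedDiscount_le hs hs1.le hGB n)
  have hstep : ∀ n, m ≤ n → ∫ ω in D, stoppedDiscount Z a s G (n + 1) ω ∂P
      = ∫ ω in D, stoppedDiscount Z a s G n ω ∂P := by
    intro n hn
    rw [← sub_eq_zero, ← integral_sub (hYI _) (hYI _)]
    simp_rw [stoppedDiscount_succ_sub]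
    have hU := measurableSet_history_lt_passageTime Z a n
    have hU' := history_le hZ.measurable n _ hU
    rw [integral_indicator hU', Measure.restrict_restrict hU', integral_const_mul]
    refine mul_eq_zero_of_right _ ?_
    -- From time `m` on, `D` belongs to the history. On this event |Z n| > a, so the resolvent
    -- equation makes the mean increment vanish.
    have hA : MeasurableSet[history Z n] ({ω | n < passageTime Z a ω} ∩ D) :=
      MeasurableSet.inter hU (history_mono Z hn _ hD)
    have hI : ∀ k, Integrable (fun ω => G (Z k ω))
        (P.restrict ({ω | n < passageTime Z a ω} ∩ D)) := fun k =>
      Integrable.of_bound (hGm.comp (hZ.measurable k)).aestronglyMeasurable (G 0)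
        (ae_of_all _ fun ω => hGB _)
    have hI2 : Integrable (fun ω => ∫ z, G (Z n ω + z) ∂(incrementLaw v))
        (P.restrict ({ω | n < passageTime Z a ω} ∩ D)) := by
      refine Integrable.of_bound ((StronglyMeasurable.integral_prod_right
        (f := fun (y z : ℝ) => G (y + z))
        (hGm.comp measurable_add).stronglyMeasurable).measurable.comp
          (hZ.measurable n)).aestronglyMeasurable (G 0) (ae_of_all _ fun ω => ?_)
      have := norm_integral_le_of_norm_le_const (μ := incrementLaw v)
        (f := fun z => G (Z n ω + z)) (ae_of_all _ fun z => hGB (Z n ω + z))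
      simpa using this
    rw [integral_sub ((hI _).const_mul s) (hI n), integral_const_mul,
      hZ.setIntegral_succ hA hGm hGB, ← integral_const_mul,
      ← integral_sub (hI2.const_mul s) (hI n)]
    refine (setIntegral_congr_fun (history_le hZ.measurable n _ hA)
      (g := fun _ => (0 : ℝ)) fun ω hω => ?_).trans (by simp)
    have h1 := potential_sub_mul_integral (a := a) hv.integral_sin_incrementLaw hs hs1 (Z n ω)
    rw [integral_fejer_mul_cos ha (lt_passageTime_iff.1 hω.1 n le_rfl), ← hG] at h1
    dsimp only
    linarith
  have hconst : ∀ n, m ≤ n → ∫ ω in D, stoppedDiscount Z a s G n ω ∂P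
      = ∫ ω in D, stoppedDiscount Z a s G m ω ∂P := fun n hn => by
    induction n, hn using Nat.le_induction with
    | base => rfl
    | succ n hn ih => rw [hstep n hn, ih]
  have hlim : Tendsto (fun n => ∫ ω in D, stoppedDiscount Z a s G n ω ∂P) atTop
      (𝓝 (∫ ω in D, discount Z a s ω * G (Z (passageTime Z a ω).toNat ω) ∂P)) :=
    tendsto_integral_of_dominated_convergence (fun _ => G 0)
      (fun n => (hYm n).aestronglyMeasurable) (integrable_const _)
      (fun n => ae_of_all _ fun ω => abs_stoppedDiscount_le hs hs1.le hGB n)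
      (ae_of_all _ fun ω => tendsto_stoppedDiscount hs hs1 hGB)
  exact tendsto_nhds_unique (tendsto_const_nhds.congr'
    ((eventually_ge_atTop m).mono fun n hn => (hconst n hn).symm)) hlim

end IsRandomWalk

end Walk

/-! ### Two-sided control of 1 - E[s^τ] -/

namespace IsRandomWalk

variable {Ω : Type*} [MeasurableSpace Ω] {P : Measure Ω} {v : ℝ → ℝ}
  {α c a s x : ℝ} {Z : ℕ → Ω → ℝ}

theorem ae_passageTime_pos (hZ : IsRandomWalk P (symDensity v) x Z) (hx : a < |x|) :
    ∀ᵐ ω ∂P, ((0 : ℕ) : ℕ∞) < passageTime Z a ω := by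
  filter_upwards [hZ.start] with ω hω
  refine lt_passageTime_iff.2 fun j hj => ?_
  rwa [Nat.le_zero.1 hj, hω]

variable [IsProbabilityMeasure P]

theorem measure_preimage_one_Icc_pos (hZ : IsRandomWalk P (symDensity v) x Z)
    (hv : IsTailDensity α c v) {l r : ℝ} (h : l < r) : 0 < P.real (Z 1 ⁻¹' Set.Icc l r) := by
  refine ENNReal.toReal_pos ?_ (measure_ne_top _ _)
  have h1 := hZ.markov 0 Set.univ MeasurableSet.univ (Set.Icc l r) measurableSet_Icc
  rw [Set.univ_inter, Measure.restrict_univ, lintegral_congr_ae (g := fun _ =>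
    ∫⁻ z in Set.Icc l r, ENNReal.ofReal (symDensity v (z - x)))] at h1
  · rw [lintegral_const, measure_univ, mul_one] at h1
    rw [zero_add] at h1
    rw [h1]
    exact (hv.setLIntegral_symDensity_sub_pos h x).ne'
  · filter_upwards [hZ.start] with ω hω
    rw [hω]

theorem integrable_discount (hZ : IsRandomWalk P (symDensity v) x Z) (hs : 0 ≤ s) (hs1 : s ≤ 1)
    (a : ℝ) : Integrable (discount Z a s) P :=
  Integrable.of_bound (measurable_discount hZ.measurable s).aestronglyMeasurable 1
    (ae_of_all _ fun _ => by
      rw [Real.norm_of_nonneg (discount_nonneg hs)]; exact discount_le_one hs hs1)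

theorem integrable_discount_mul_potential (hZ : IsRandomWalk P (symDensity v) x Z)
    (hv : IsTailDensity α c v) (hs : 0 ≤ s) (hs1 : s < 1) (a : ℝ) :
    Integrable (fun ω => discount Z a s ω * potential a (cosTransform (incrementLaw v)) s
        (Z (passageTime Z a ω).toNat ω)) P := by
  have := hv.isProbabilityMeasure_incrementLaw
  have hG := (continuous_potential (a := a) (measurable_cosTransform (ν := incrementLaw v)) hs hs1
    abs_cosTransform_le).measurable
  have h1 : Measurable fun p : ℕ × Ω =>
      potential a (cosTransform (incrementLaw v)) s (Z p.1 p.2) :=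
    measurable_from_prod_countable_right fun k => hG.comp (hZ.measurable k)
  have h2 : Measurable fun ω => (passageTime Z a ω).toNat :=
    (measurable_of_countable ENat.toNat).comp (measurable_passageTime hZ.measurable)
  exact (hZ.integrable_discount hs hs1.le a).mul_bdd
    (c := potential a (cosTransform (incrementLaw v)) s 0)
    (h1.comp (h2.prodMk measurable_id)).aestronglyMeasurable
    (ae_of_all _ fun ω => abs_potential_le measurable_cosTransform hs hs1 abs_cosTransform_le _)

theorem potential_zero_nonneg (hv : IsTailDensity α c v) (hs : 0 ≤ s) (hs1 : s < 1) :
    0 ≤ potential a (cosTransform (incrementLaw v)) s 0 := by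
  have := hv.isProbabilityMeasure_incrementLaw
  exact (abs_nonneg _).trans
    (abs_potential_le measurable_cosTransform hs hs1 abs_cosTransform_le 0)

/-- Optional stopping from time 0, with G(Z τ) replaced by its upper bound G(0). -/
theorem potential_zero_mul_le (hZ : IsRandomWalk P (symDensity v) x Z)
    (hv : IsTailDensity α c v) (ha : 0 < a) (hs : 0 ≤ s) (hs1 : s < 1) :
    potential a (cosTransform (incrementLaw v)) s 0 * (1 - ∫ ω, discount Z a s ω ∂P)
      ≤ potential a (cosTransform (incrementLaw v)) s 0
        - potential a (cosTransform (incrementLaw v)) s x := by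
  have := hv.isProbabilityMeasure_incrementLaw
  have h := hZ.setIntegral_stoppedDiscount hv ha hs hs1 (m := 0) (D := Set.univ)
    MeasurableSet.univ
  rw [Measure.restrict_univ] at h
  set G := potential a (cosTransform (incrementLaw v)) s
  have h0 : ∫ ω, stoppedDiscount Z a s G 0 ω ∂P = G x := by
    rw [integral_congr_ae (g := fun _ => G x)]
    · simp
    · filter_upwards [hZ.start] with ω hω
      rw [stoppedDiscount_of_le (by simp), hω, pow_zero, one_mul]
  have h1 : ∫ ω, discount Z a s ω * G (Z (passageTime Z a ω).toNat ω) ∂P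
      ≤ ∫ ω, G 0 * discount Z a s ω ∂P := by
    refine integral_mono (hZ.integrable_discount_mul_potential hv hs hs1 a)
      ((hZ.integrable_discount hs hs1.le a).const_mul _) fun ω => ?_
    dsimp only
    rw [mul_comm]
    exact mul_le_mul_of_nonneg_right
      (potential_le measurable_cosTransform hs hs1 abs_cosTransform_le _) (discount_nonneg hs)
  rw [integral_const_mul] at h1
  linarith

/-- Stopping starts at time 1 on the event that the first jump lands in [l, r]: the starting point
itself may lie too near [-a, a] for G(0) - G(x) to dominate `A`. -/
theorem le_potential_zero_mul (hZ : IsRandomWalk P (symDensity v) x Z)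
    (hv : IsTailDensity α c v) (ha : 0 < a) (hx : a < |x|) (hs : 0 ≤ s) (hs1 : s < 1)
    {A B l r : ℝ} (hA0 : 0 ≤ A)
    (hA : ∀ y, |y| ≤ a → potential a (cosTransform (incrementLaw v)) s 0
        - potential a (cosTransform (incrementLaw v)) s y ≤ A)
    (hB : ∀ y ∈ Set.Icc l r, B ≤ potential a (cosTransform (incrementLaw v)) s 0
        - potential a (cosTransform (incrementLaw v)) s y) :
    (s * B - A) * P.real (Z 1 ⁻¹' Set.Icc l r)
      ≤ potential a (cosTransform (incrementLaw v)) s 0 * (1 - ∫ ω, discount Z a s ω ∂P) := by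
  have := hv.isProbabilityMeasure_incrementLaw
  have hG0 := potential_zero_nonneg (a := a) hv hs hs1
  set D := Z 1 ⁻¹' Set.Icc l r with hD
  have hDm : MeasurableSet D := hZ.measurable 1 measurableSet_Icc
  have h := hZ.setIntegral_stoppedDiscount hv ha hs hs1 (m := 1) (D := D)
    (measurable_history Z le_rfl measurableSet_Icc)
  have hI := (hZ.integrable_discount_mul_potential hv hs hs1 a).integrableOn (s := D)
  have hId := hZ.integrable_discount hs hs1.le a
  have hGm := (continuous_potential (a := a) (measurable_cosTransform (ν := incrementLaw v)) hs hs1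
    abs_cosTransform_le).measurable
  have hGB := abs_potential_le (a := a) (measurable_cosTransform (ν := incrementLaw v)) hs hs1
    abs_cosTransform_le
  set G := potential a (cosTransform (incrementLaw v)) s
  have h1 : ∫ ω in D, stoppedDiscount Z a s G 1 ω ∂P ≤ ∫ _ in D, s * (G 0 - B) ∂P := by
    refine integral_mono_ae ?_ (integrable_const _) ?_
    · exact Integrable.of_bound
        (measurable_stoppedDiscount hZ.measurable hGm 1).aestronglyMeasurable (G 0)
        (ae_of_all _ fun ω => abs_stoppedDiscount_le hs hs1.le hGB 1)
    · filter_upwards [ae_restrict_mem hDm, ae_restrict_of_ae (hZ.ae_passageTime_pos hx)]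
        with ω hω hτ
      rw [stoppedDiscount_of_le (by exact_mod_cast Order.add_one_le_of_lt hτ), pow_one]
      have := hB _ hω
      exact mul_le_mul_of_nonneg_left (by linarith) hs
  have h2 : ∫ ω in D, (G 0 * discount Z a s ω - A) ∂P
      ≤ ∫ ω in D, discount Z a s ω * G (Z (passageTime Z a ω).toNat ω) ∂P := by
    refine integral_mono ((hId.integrableOn.const_mul _).sub (integrable_const _)) hI fun ω => ?_
    dsimp only
    by_cases hτ : passageTime Z a ω = ⊤
    · simp [discount, hτ, hA0]
    · have h3 := hA _ (abs_le_of_passageTime_eq (ENat.natCast_toNat hτ).symm)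
      have h4 := discount_nonneg (Z := Z) (a := a) (ω := ω) hs
      have h5 := discount_le_one (Z := Z) (a := a) (ω := ω) hs hs1.le
      nlinarith
  rw [integral_sub (hId.integrableOn.const_mul _) (integrable_const _), integral_const_mul] at h2
  have h6 : ∫ ω in D, (1 - discount Z a s ω) ∂P ≤ ∫ ω, (1 - discount Z a s ω) ∂P :=
    setIntegral_le_integral ((integrable_const _).sub hId)
      (ae_of_all _ fun ω => sub_nonneg.2 (discount_le_one hs hs1.le))
  rw [integral_sub (integrable_const _) hId.integrableOn, integral_sub (integrable_const _) hId]
    at h6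
  simp only [integral_const, smul_eq_mul, probReal_univ, mul_one, measureReal_restrict_apply_univ] at h1 h2 h6
  have h7 := mul_le_mul_of_nonneg_left h6 hG0
  have h8 : s * (G 0 * P.real D) ≤ 1 * (G 0 * P.real D) :=
    mul_le_mul_of_nonneg_right hs1.le (mul_nonneg hG0 measureReal_nonneg)
  linarith

end IsRandomWalk

/-! ### Pathwise comparison of τ^q with 1 - s^τ -/

section SamplePath

variable {Ω : Type*} {a : ℝ} {Z : ℕ → Ω → ℝ}

/-- With u = (1-s)n, Bernoulli gives 1 - s^n ≤ min(1, u), which is at most u^q for 0 < q ≤ 1. -/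
theorem one_sub_pow_le_rpow {s q : ℝ} (hs : 0 ≤ s) (hs1 : s ≤ 1) (hq0 : 0 < q) (hq : q ≤ 1)
    (n : ℕ) : 1 - s ^ n ≤ ((1 - s) * n) ^ q := by
  have hx : 0 ≤ (1 - s) * n := mul_nonneg (by linarith) n.cast_nonneg
  rcases le_total ((1 - s) * n) 1 with h | h
  · have h1 := one_add_mul_le_pow (a := s - 1) (by linarith) n
    rw [add_sub_cancel] at h1
    have h2 : (1 - s) * n ≤ ((1 - s) * n) ^ q := by
      rcases hx.eq_or_lt with h0 | h0
      · rw [← h0]; exact Real.rpow_nonneg le_rfl _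
      · simpa using Real.rpow_le_rpow_of_exponent_ge h0 h hq
    linarith
  · have := Real.one_le_rpow h hq0.le
    have := pow_nonneg hs n
    linarith

theorem half_le_one_sub_discount {k : ℕ} {ω : Ω} (h : ((2 ^ k : ℕ) : ℕ∞) ≤ passageTime Z a ω) :
    1 / 2 ≤ 1 - discount Z a (1 - 1 / 2 ^ k) ω := by
  have hk : (1 : ℝ) ≤ 2 ^ k := one_le_pow₀ one_le_two
  have hk' : (1 : ℝ) / 2 ^ k ≤ 1 := by rw [div_le_one (by positivity)]; exact hk
  have hk0 : (0 : ℝ) < 1 / 2 ^ k := by positivity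
  rw [discount]
  split_ifs with hτ
  · norm_num
  · obtain ⟨n, hn⟩ := ENat.ne_top_iff_exists.1 hτ
    rw [← hn] at h ⊢
    have h1 : 2 ^ k ≤ n := by exact_mod_cast h
    -- (1 - 2^(-k))^(2^k) ≤ e^(-1) ≤ 1/2.
    have h2 := Real.one_sub_div_pow_le_exp_neg (n := 2 ^ k) (t := 1) (by exact_mod_cast hk)
    have h3 : (1 - 1 / 2 ^ k : ℝ) ^ n ≤ (1 - 1 / 2 ^ k : ℝ) ^ (2 ^ k) :=
      pow_le_pow_of_le_one (by linarith) (by linarith) h1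
    have h4 : Real.exp (-1) ≤ 1 / 2 := by
      rw [Real.exp_neg, inv_le_comm₀ (Real.exp_pos _) (by norm_num)]
      linarith [Real.add_one_le_exp 1]
    push_cast at h2
    rw [ENat.toNat_natCast]
    linarith

/-- For finite τ ≥ 2^k₀ the single term of its dyadic block dominates; for τ = ∞ every term is at
least 1 and the series diverges. -/
theorem rpow_passageTime_le {q : ℝ} (hq : 0 < q) (k₀ : ℕ) (ω : Ω) :
    ((passageTime Z a ω : ℕ∞) : ℝ≥0∞) ^ q ≤ ENNReal.ofReal (2 ^ (k₀ * q))
      + ∑' j : ℕ, ENNReal.ofReal (2 * 2 ^ ((k₀ + j + 1) * q))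
        * ENNReal.ofReal (1 - discount Z a (1 - 1 / 2 ^ (k₀ + j)) ω) := by
  have hterm : ∀ j : ℕ, ((2 ^ (k₀ + j) : ℕ) : ℕ∞) ≤ passageTime Z a ω →
      ENNReal.ofReal (2 ^ ((k₀ + j + 1) * q)) ≤ ENNReal.ofReal (2 * 2 ^ ((k₀ + j + 1) * q))
        * ENNReal.ofReal (1 - discount Z a (1 - 1 / 2 ^ (k₀ + j)) ω) := fun j hj => by
    rw [← ENNReal.ofReal_mul (by positivity)]
    refine ENNReal.ofReal_le_ofReal ?_
    have h1 := half_le_one_sub_discount hj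
    have h2 : (0 : ℝ) < 2 ^ ((k₀ + j + 1) * q) := by positivity
    nlinarith
  induction h : passageTime Z a ω using ENat.recTopCoe with
  | top =>
    refine le_trans le_top (le_trans ?_ le_add_self)
    rw [← ENNReal.tsum_const_eq_top_of_ne_zero (α := ℕ) (c := 1) one_ne_zero]
    refine ENNReal.tsum_le_tsum fun j => le_trans ?_ (hterm j (by rw [h]; exact le_top))
    rw [ENNReal.one_le_ofReal]
    exact Real.one_le_rpow one_le_two (by positivity)
  | coe n =>
    rw [ENat.toENNReal_coe, ← ENNReal.ofReal_natCast,
      ENNReal.ofReal_rpow_of_nonneg n.cast_nonneg hq.le]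
    have hpow : ∀ m : ℕ, n ≤ 2 ^ m → (n : ℝ) ^ q ≤ 2 ^ (m * q) := fun m hm => by
      rw [Real.rpow_mul zero_le_two, Real.rpow_natCast]
      exact Real.rpow_le_rpow n.cast_nonneg (by exact_mod_cast hm) hq.le
    rcases le_total n (2 ^ k₀) with hn | hn
    · exact (ENNReal.ofReal_le_ofReal (hpow k₀ hn)).trans le_self_add
    · have hn0 : n ≠ 0 := by
        have : 0 < 2 ^ k₀ := by positivity
        omega
      obtain ⟨j, hj⟩ := Nat.exists_eq_add_of_le
        ((Nat.le_log_iff_pow_le one_lt_two hn0).2 hn)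
      have h1 : 2 ^ (k₀ + j) ≤ n := hj ▸ Nat.pow_log_le_self 2 hn0
      have h2 : n ≤ 2 ^ (k₀ + j + 1) := hj ▸ (Nat.lt_pow_succ_log_self one_lt_two n).le
      have h3 := hpow _ h2
      push_cast at h3
      refine (ENNReal.ofReal_le_ofReal h3).trans (((hterm j ?_).trans
        (ENNReal.le_tsum j)).trans le_add_self)
      rw [h]
      exact_mod_cast h1

end SamplePath

/-! ### From 1 - E[s^τ] to moments of τ -/

section Moments

variable {Ω : Type*} [MeasurableSpace Ω] {P : Measure Ω} [IsProbabilityMeasure P]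
  {a : ℝ} {Z : ℕ → Ω → ℝ}

theorem lintegral_one_sub_discount (hZ : ∀ n, Measurable (Z n)) {s : ℝ} (hs : 0 ≤ s)
    (hs1 : s ≤ 1) : ∫⁻ ω, ENNReal.ofReal (1 - discount Z a s ω) ∂P
      = ENNReal.ofReal (1 - ∫ ω, discount Z a s ω ∂P) := by
  have hI : Integrable (discount Z a s) P :=
    Integrable.of_bound (measurable_discount hZ s).aestronglyMeasurable 1
      (ae_of_all _ fun _ => by
        rw [Real.norm_of_nonneg (discount_nonneg hs)]; exact discount_le_one hs hs1)
  have hI' : Integrable (fun ω => 1 - discount Z a s ω) P := (integrable_const _).sub hI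
  rw [← ofReal_integral_eq_lintegral_ofReal hI'
    (ae_of_all _ fun ω => sub_nonneg.2 (discount_le_one hs hs1)),
    integral_sub (integrable_const _) hI]
  simp

theorem one_sub_integral_discount_le (hZ : ∀ n, Measurable (Z n)) {q : ℝ} (hq0 : 0 < q)
    (hq : q ≤ 1) (hM : passageMoment P Z a q ≠ ∞) {s : ℝ} (hs : 0 ≤ s) (hs1 : s < 1) :
    1 - ∫ ω, discount Z a s ω ∂P ≤ (1 - s) ^ q * (passageMoment P Z a q).toReal := by
  have hs' : 0 < 1 - s := by linarith
  have h1 : ∀ ω, ENNReal.ofReal (1 - discount Z a s ω)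
      ≤ ENNReal.ofReal ((1 - s) ^ q) * ((passageTime Z a ω : ℕ∞) : ℝ≥0∞) ^ q := fun ω => by
    rw [discount]
    induction h : passageTime Z a ω using ENat.recTopCoe with
    | top =>
      rw [ENat.toENNReal_top, ENNReal.top_rpow_of_pos hq0, ENNReal.mul_top]
      · exact le_top
      · exact (ENNReal.ofReal_pos.2 (Real.rpow_pos_of_pos hs' _)).ne'
    | coe n =>
      rw [if_neg (ENat.natCast_ne_top n), ENat.toNat_natCast, ENat.toENNReal_coe,
        ← ENNReal.ofReal_natCast, ENNReal.ofReal_rpow_of_nonneg n.cast_nonneg hq0.le,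
        ← ENNReal.ofReal_mul (Real.rpow_nonneg hs'.le _),
        ← Real.mul_rpow hs'.le n.cast_nonneg]
      exact ENNReal.ofReal_le_ofReal (one_sub_pow_le_rpow hs hs1.le hq0 hq n)
  have h2 := lintegral_mono (μ := P) h1
  rw [lintegral_one_sub_discount hZ hs hs1.le,
    lintegral_const_mul' _ _ ENNReal.ofReal_ne_top] at h2
  change _ ≤ _ * passageMoment P Z a q at h2
  rw [← ENNReal.ofReal_toReal hM, ← ENNReal.ofReal_mul (Real.rpow_nonneg hs'.le _),
    ENNReal.ofReal_le_ofReal_iff (mul_nonneg (Real.rpow_nonneg hs'.le _)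
      ENNReal.toReal_nonneg)] at h2
  exact h2

theorem passageMoment_lt_top (hZ : ∀ n, Measurable (Z n)) {q p C s₀ : ℝ} (hq : 0 < q)
    (hqp : q < p) (hs₀ : s₀ < 1)
    (h : ∀ s, s₀ ≤ s → 0 ≤ s → s < 1 → 1 - ∫ ω, discount Z a s ω ∂P ≤ C * (1 - s) ^ p) :
    passageMoment P Z a q < ∞ := by
  obtain ⟨k₀, hk₀⟩ := exists_pow_lt_of_lt_one (sub_pos.2 hs₀) one_half_lt_one
  have hk : ∀ j : ℕ, (1 : ℝ) / 2 ^ (k₀ + j) ≤ 1 - s₀ := fun j => by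
    rw [← one_div_pow]
    exact (pow_le_pow_of_le_one (by norm_num) (by norm_num) (Nat.le_add_right _ _)).trans hk₀.le
  have hk1 : ∀ j : ℕ, (1 : ℝ) / 2 ^ (k₀ + j) ≤ 1 := fun j => by
    rw [div_le_one (by positivity)]; exact one_le_pow₀ one_le_two
  have hk0 : ∀ j : ℕ, (0 : ℝ) < 1 / 2 ^ (k₀ + j) := fun j => by positivity
  have hm : ∀ j : ℕ, Measurable fun ω => ENNReal.ofReal (2 * 2 ^ ((k₀ + j + 1) * q))
      * ENNReal.ofReal (1 - discount Z a (1 - 1 / 2 ^ (k₀ + j)) ω) := fun j =>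
    (measurable_const.sub (measurable_discount hZ _)).ennreal_ofReal.const_mul _
  refine (lintegral_mono (rpow_passageTime_le hq k₀)).trans_lt ?_
  rw [lintegral_add_left measurable_const, lintegral_const, measure_univ, mul_one,
    lintegral_tsum fun j => (hm j).aemeasurable]
  refine ENNReal.add_lt_top.2 ⟨ENNReal.ofReal_lt_top, ?_⟩
  -- At s = 1 - 2^(-k), with k = k₀ + j, a block contributes about 2^(kq) · 2^(-kp): a geometric
  -- series, as q < p.
  have hsum : Summable fun j : ℕ => 2 * 2 ^ ((k₀ + 1) * q) * C * 2 ^ (-(k₀ * p))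
      * ((2 : ℝ) ^ (q - p)) ^ j :=
    (summable_geometric_of_lt_one (by positivity)
      (Real.rpow_lt_one_of_one_lt_of_neg one_lt_two (by linarith))).mul_left _
  refine lt_of_le_of_lt (ENNReal.tsum_le_tsum fun j => ?_) hsum.tsum_ofReal_lt_top
  rw [lintegral_const_mul' _ _ ENNReal.ofReal_ne_top,
    lintegral_one_sub_discount hZ (by linarith [hk1 j]) (by linarith [hk0 j]),
    ← ENNReal.ofReal_mul (by positivity)]
  refine ENNReal.ofReal_le_ofReal ?_
  have h1 := h (1 - 1 / 2 ^ (k₀ + j)) (by linarith [hk j]) (by linarith [hk1 j])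
    (by linarith [hk0 j])
  calc _ ≤ 2 * (2 : ℝ) ^ ((k₀ + j + 1) * q) * (C * (1 - (1 - 1 / 2 ^ (k₀ + j))) ^ p) := by gcongr
    _ = _ := by
      have e1 : (1 - (1 - 1 / 2 ^ (k₀ + j)) : ℝ) ^ p = 2 ^ (-((k₀ + j) * p)) := by
        rw [sub_sub_cancel, one_div, ← Real.rpow_natCast, ← Real.rpow_neg zero_le_two,
          ← Real.rpow_mul zero_le_two]
        push_cast
        ring_nf
      have e2 : ((2 : ℝ) ^ (q - p)) ^ j = 2 ^ ((q - p) * j) := by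
        rw [Real.rpow_mul zero_le_two, Real.rpow_natCast]
      rw [e1, e2]
      have e3 : (2 : ℝ) ^ ((k₀ + j + 1) * q) * 2 ^ (-((k₀ + j) * p))
          = 2 ^ ((k₀ + 1) * q) * 2 ^ (-(k₀ * p)) * 2 ^ ((q - p) * j) := by
        rw [← Real.rpow_add two_pos, ← Real.rpow_add two_pos, ← Real.rpow_add two_pos]
        ring_nf
      linear_combination 2 * C * e3

theorem passageMoment_lt_top_of_le {q q' : ℝ} (hq' : 0 ≤ q') (h : q' ≤ q)
    (hM : passageMoment P Z a q < ∞) : passageMoment P Z a q' < ∞ := by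
  have h1 : ∀ ω, ((passageTime Z a ω : ℕ∞) : ℝ≥0∞) ^ q'
      ≤ 1 + ((passageTime Z a ω : ℕ∞) : ℝ≥0∞) ^ q := fun ω => by
    rcases le_total ((passageTime Z a ω : ℕ∞) : ℝ≥0∞) 1 with h2 | h2
    · exact (ENNReal.rpow_le_one h2 hq').trans le_self_add
    · exact (ENNReal.rpow_le_rpow_of_exponent_le h2 h).trans le_add_self
  refine (lintegral_mono h1).trans_lt ?_
  rw [lintegral_add_left measurable_const]
  exact ENNReal.add_lt_top.2 ⟨by simp, hM⟩

theorem passageMoment_lt_top_of_nonpos {q : ℝ} (hq : q ≤ 0)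
    (h : ∀ᵐ ω ∂P, ((0 : ℕ) : ℕ∞) < passageTime Z a ω) : passageMoment P Z a q < ∞ := by
  refine (lintegral_mono_ae (g := fun _ => 1) ?_).trans_lt (by simp)
  filter_upwards [h] with ω hω
  have h1 : (1 : ℕ∞) ≤ passageTime Z a ω := by simpa using Order.add_one_le_of_lt hω
  have h2 : (1 : ℝ≥0∞) ≤ ((passageTime Z a ω : ℕ∞) : ℝ≥0∞) := by exact_mod_cast h1
  simpa using ENNReal.rpow_le_rpow_of_exponent_le h2 hq

end Moments

/-! ### Both halves of the theorem, with β = min α 2 -/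

theorem exists_min_rpow_le_one_sub_cosTransform {α c : ℝ} {v : ℝ → ℝ} (hv : IsTailDensity α c v)
    (hc : 0 < c) (hα : 1 < α) :
    ∃ κ : ℝ, 0 < κ ∧
      ∀ t, κ * (min 1 |t|) ^ (min α 2) ≤ 1 - cosTransform (incrementLaw v) t := by
  rcases le_total α 2 with h | h
  · rw [min_eq_left h]; exact hv.exists_rpow_le_one_sub_cosTransform hc hα
  · rw [min_eq_right h]; exact hv.exists_sq_le_one_sub_cosTransform hc hα

namespace IsRandomWalk

variable {Ω : Type*} [MeasurableSpace Ω] {P : Measure Ω} [IsProbabilityMeasure P] {v : ℝ → ℝ}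
  {α c a x q : ℝ} {Z : ℕ → Ω → ℝ}

theorem passageMoment_lt_top (hZ : IsRandomWalk P (symDensity v) x Z)
    (hv : IsTailDensity α c v) (hc : 0 < c) (hα : 1 < α) (ha : 0 < a) (hx : a < |x|)
    (hq : q < 1 - 1 / min α 2) : passageMoment P Z a q < ∞ := by
  rcases le_or_gt q 0 with hq0 | hq0
  · exact passageMoment_lt_top_of_nonpos hq0 (hZ.ae_passageTime_pos hx)
  have := hv.isProbabilityMeasure_incrementLaw
  obtain ⟨κ, hκ, hL⟩ := exists_min_rpow_le_one_sub_cosTransform hv hc hα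
  set β := min α 2 with hβ
  have hβ1 : 1 < β := lt_min hα one_lt_two
  have hβ2 : β ≤ 2 := min_le_right _ _
  have hβα : β ≤ α := min_le_left _ _
  -- With b = 1/r < β, the decay exponent 1 - r of 1 - E[s^τ] still exceeds q.
  obtain ⟨r, hr1, hr2⟩ := exists_between (show 1 / β < 1 - q by linarith)
  have hr0 : 0 < r := lt_trans (by positivity) hr1
  have hbβ : 1 / r < β := by
    rw [div_lt_comm₀ hr0 (by linarith)]; exact hr1
  obtain ⟨M, hM, hU⟩ := hv.exists_one_sub_cosTransform_le (b := 1 / r) (by positivity)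
    (hbβ.trans_le hβα) (hbβ.le.trans hβ2)
  set A := 4 / κ * (∫ t, fejer a t) * (1 + x ^ 2)
  set k := a ^ 2 / 8 / (1 + M) with hk
  have hk0 : 0 < k := by positivity
  have hsa : 0 < (1 / a) ^ (1 / r) := Real.rpow_pos_of_pos (by positivity) _
  refine HeavyTailed.passageMoment_lt_top hZ.measurable (p := 1 - r) (C := A / k)
    (s₀ := max (1 / 2) (1 - (1 / a) ^ (1 / r))) hq0 (by linarith)
    (max_lt (by norm_num) (by linarith)) fun s hs hs0 hs1 => ?_
  have hs' : 0 < 1 - s := by linarith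
  have h1 := hZ.potential_zero_mul_le hv ha hs0 hs1
  have h2 := potential_zero_sub_le (a := a) measurable_cosTransform abs_cosTransform_le hκ hβ2 hL
    ((le_max_left _ _).trans hs) hs1 x
  have h3 := potential_zero_ge measurable_cosTransform abs_cosTransform_le ha hM (by positivity)
    hU hs0 hs1 (by
      rw [one_div_one_div]
      calc (1 - s) ^ r ≤ ((1 / a) ^ (1 / r)) ^ r := by
            gcongr
            linarith [(le_max_right _ _).trans hs]
        _ = 1 / a := by
          rw [← Real.rpow_mul (by positivity), one_div_mul_cancel hr0.ne', Real.rpow_one])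
  rw [one_div_one_div, ← hk] at h3
  have hE : 0 ≤ 1 - ∫ ω, discount Z a s ω ∂P := by
    have := integral_mono (hZ.integrable_discount hs0 hs1.le a) (integrable_const (1 : ℝ))
      fun ω => discount_le_one hs0 hs1.le
    simpa using this
  have h4 := (mul_le_mul_of_nonneg_right h3 hE).trans (h1.trans h2)
  have hp : 0 < (1 - s) ^ (r - 1) := Real.rpow_pos_of_pos hs' _
  rw [show (1 : ℝ) - r = -(r - 1) by ring, Real.rpow_neg hs'.le, ← div_eq_mul_inv, div_div,
    le_div_iff₀ (by positivity), mul_comm]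
  exact h4

theorem passageMoment_eq_top (hZ : IsRandomWalk P (symDensity v) x Z)
    (hv : IsTailDensity α c v) (hc : 0 < c) (hα : 1 < α) (ha : 0 < a) (hx : a < |x|)
    (hq : 1 - 1 / min α 2 < q) : passageMoment P Z a q = ∞ := by
  have := hv.isProbabilityMeasure_incrementLaw
  obtain ⟨κ, hκ, hL⟩ := exists_min_rpow_le_one_sub_cosTransform hv hc hα
  set β := min α 2 with hβ
  have hβ1 : 1 < β := lt_min hα one_lt_two
  have hβ2 : β ≤ 2 := min_le_right _ _
  have hβα : β ≤ α := min_le_left _ _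
  have hβi : 1 / β < 1 := by rw [div_lt_one (by linarith)]; exact hβ1
  have hβi0 : 0 < 1 / β := by positivity
  by_contra hfin
  -- The bound by (1-s)^q needs q ≤ 1; lowering q to `min q 1` keeps it above the threshold.
  have hq1 : 1 - 1 / β < min q 1 := lt_min hq (by linarith)
  have hq0 : 0 < min q 1 := by linarith
  have hfin' := (passageMoment_lt_top_of_le hq0.le (min_le_left q 1) (lt_top_iff_ne_top.2 hfin)).ne
  generalize hq'1 : min q 1 = q' at hq1 hq0 hfin'
  have hq'le : q' ≤ 1 := hq'1 ▸ min_le_right _ _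
  -- θ < 1/β bounds G(0) by (1-s)^(θ-1), and θ > 1 - q' makes the final exponent θ - 1 + q'
  -- positive.
  obtain ⟨θ, hθ1, hθ2⟩ := exists_between (show 1 - q' < 1 / β by linarith)
  have hθβ : β * θ < 1 := by rwa [lt_div_iff₀ (by linarith), mul_comm] at hθ2
  obtain ⟨b, hb1, hbβ⟩ := exists_between hβ1
  obtain ⟨M, hM, hU⟩ := hv.exists_one_sub_cosTransform_le (b := b) (by linarith)
    (hbβ.trans_le hβα) (hbβ.le.trans hβ2)
  set A := 4 / κ * (∫ t, fejer a t) * (1 + a ^ 2) with hA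
  have hF : 0 ≤ 4 / κ * ∫ t, fejer a t :=
    mul_nonneg (by positivity) (integral_nonneg (fejer_nonneg a))
  have hA0 : 0 ≤ A := mul_nonneg hF (by positivity)
  -- The level 2(A + 1) ensures s · 2(A + 1) - A ≥ 1 for s ≥ 1/2.
  obtain ⟨R, s₀, -, hs₀, hR⟩ := exists_le_potential_zero_sub measurable_cosTransform
    abs_cosTransform_le ha hM hb1 (hbβ.le.trans hβ2) hU (2 * (A + 1)) 0
  have hD := hZ.measure_preimage_one_Icc_pos hv (lt_add_one R)
  set δ := P.real (Z 1 ⁻¹' Set.Icc R (R + 1))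
  set B := (κ / 2) ^ (-θ) * ∫ t, fejer a t * min 1 |t| ^ (-(β * θ))
  have key : ∀ s, s₀ ≤ s → 1 / 2 ≤ s → s < 1 →
      δ ≤ B * (passageMoment P Z a q').toReal * (1 - s) ^ (θ - 1 + q') := by
    intro s hs hs2 hs1
    have hs0 : 0 ≤ s := by linarith
    have hs' : 0 < 1 - s := by linarith
    have h1 := hZ.le_potential_zero_mul hv ha hx hs0 hs1 hA0 (B := 2 * (A + 1)) (l := R)
      (r := R + 1) (fun y hy => by
        refine (potential_zero_sub_le (a := a) measurable_cosTransform abs_cosTransform_le hκ hβ2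
          hL hs2 hs1 y).trans ?_
        rw [hA, ← sq_abs y]
        gcongr) fun y hy => hR s y hs hs0 hs1 hy.1 hy.2
    have h2 := potential_zero_le (a := a) measurable_cosTransform abs_cosTransform_le hκ hL
      (by linarith : 0 ≤ θ) (by linarith : θ ≤ 1) hθβ hs2 hs1
    have h3 := one_sub_integral_discount_le hZ.measurable hq0 hq'le hfin' hs0 hs1
    have h4 := potential_zero_nonneg (a := a) hv hs0 hs1
    have h5 : 1 * δ ≤ (s * (2 * (A + 1)) - A) * δ := by
      refine mul_le_mul_of_nonneg_right ?_ hD.le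
      nlinarith
    have hN : 0 ≤ (1 - s) ^ q' * (passageMoment P Z a q').toReal :=
      mul_nonneg (Real.rpow_nonneg hs'.le _) ENNReal.toReal_nonneg
    calc δ = 1 * δ := (one_mul _).symm
      _ ≤ _ := h5.trans h1
      _ ≤ _ := mul_le_mul_of_nonneg_left h3 h4
      _ ≤ _ := mul_le_mul_of_nonneg_right h2 hN
      _ = _ := by rw [Real.rpow_add hs']; ring
  have hlim : Tendsto (fun u : ℝ =>
      B * (passageMoment P Z a q').toReal * u ^ (θ - 1 + q')) (𝓝[>] 0) (𝓝 0) := by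
    have h1 : ContinuousAt (fun u : ℝ => u ^ (θ - 1 + q')) 0 :=
      Real.continuousAt_rpow_const _ _ (Or.inr (by linarith))
    have h2 := (h1.tendsto.const_mul (B * (passageMoment P Z a q').toReal)).mono_left
      (nhdsWithin_le_nhds (s := Set.Ioi 0))
    rwa [Real.zero_rpow (by linarith), mul_zero] at h2
  obtain ⟨u, hu1, hu2, hu3⟩ := ((hlim.eventually (gt_mem_nhds hD)).and
    (Ioo_mem_nhdsGT (show (0 : ℝ) < min (1 / 2) (1 - s₀) from
      lt_min (by norm_num) (by linarith)))).exists
  have h1 := key (1 - u) (by linarith [hu3.trans_le (min_le_right _ _)])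
    (by linarith [hu3.trans_le (min_le_left _ _)]) (by linarith)
  rw [sub_sub_cancel] at h1
  linarith

end IsRandomWalk

end HeavyTailed

theorem theorem3p2 {α c : ℝ} (hα : 1 < α) (hc : 0 < c) {v : ℝ → ℝ}
    (hv : HeavyTailed.IsTailDensity α c v)
    {Ω : Type*} [MeasurableSpace Ω] (P : Measure Ω) [IsProbabilityMeasure P]
    {a x : ℝ} (ha : 0 < a) (hx : x ∉ Set.Icc (-a) a)
    (Z : ℕ → Ω → ℝ) (hZ : HeavyTailed.IsRandomWalk P (HeavyTailed.symDensity v) x Z) :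
    (2 ≤ α →
      (∀ q : ℝ, q < 1 / 2 → HeavyTailed.passageMoment P Z a q < ∞) ∧
      (∀ q : ℝ, 1 / 2 < q → HeavyTailed.passageMoment P Z a q = ∞)) ∧
    (α < 2 →
      (∀ q : ℝ, q < 1 - 1 / α → HeavyTailed.passageMoment P Z a q < ∞) ∧
      (∀ q : ℝ, 1 - 1 / α < q → HeavyTailed.passageMoment P Z a q = ∞)) := by
  have hx' : a < |x| := by
    by_contra! h
    exact hx (abs_le.1 h)
  have hfin := fun q => hZ.passageMoment_lt_top (q := q) hv hc hα ha hx'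
  have htop := fun q => hZ.passageMoment_eq_top (q := q) hv hc hα ha hx'
  refine ⟨fun h => ?_, fun h => ?_⟩
  · rw [min_eq_right h, show (1 : ℝ) - 1 / 2 = 1 / 2 by norm_num] at hfin htop
    exact ⟨hfin, htop⟩
  · rw [min_eq_left h.le] at hfin htop
    exact ⟨hfin, htop⟩
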